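/- Let $n\ge 2$ and let $M$ be a (Hausdorff) smooth $n$-dimensional manifold without boundary, with a smooth Riemannian metric $g$ and a smooth torsion-free affine connection $\nabla$ such that the cubic form $\nabla g$ is symmetric (that is, $(g,\nabla)$ is a statistical structure). Let $\hat\nabla$ be the Levi-Civita connection of $g$, $A=-\tfrac12\nabla g$, and suppose that the structure is trace-free: $\operatorname{tr}_g A(X,\cdot,\cdot)=0$ for every tangent vector $X$. Suppose that the curvature tensor $R(X,Y)Z=\nabla_X\nabla_YZ-\nabla_Y\nabla_XZ-\nabla_{[X,Y]}Z$ of $\nabla$ satisfies $R=HR_0$ for some function $H:M\to\mathbb R$, where $R_0(X,Y)Z=g(Y,Z)X-g(X,Z)Y$. Put $u=\|A\|^2=\sum_{i,j,k}A(e_i,e_j,e_k)^2$, $\|\hat\nabla A\|^2=\sum_{i,j,k,l}\big((\hat\nabla_{e_i}A)(e_j,e_k,e_l)\big)^2$ and $\Delta u=\operatorname{tr}_g\hat\nabla^2u$, where $(e_i)$ is any $g$-orthonormal basis of the tangent space. Then, at every point of $M$, $$(n+1)Hu+\frac{n+1}{n(n-1)}\,u^2+\|\hat\nabla A\|^2\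 \le\ \tfrac12\,\Delta u\ \le\ (n+1)Hu+\tfrac32\,u^2+\|\hat\nabla A\|^2 .$$ If $n=2$, both inequalities are equalities at every point of $M$. -/

import Mathlib

open Bundle VectorField
open scoped Manifold ContDiff

namespace StatGeom

noncomputable section

section InnerDeriv

variable {E : Type*} [NormedAddCommGroup E] [NormedSpace ℝ E]
  {H : Type*} [TopologicalSpace H] {I : ModelWithCorners ℝ E H}
  {M : Type*} [TopologicalSpace M] [ChartedSpace H M] [IsManifold I ∞ M]
  [RiemannianBundle (fun x : M => TangentSpace I x)]

/-- The Koszul expression `X g(Y,Z) + Y g(Z,X) - Z g(X,Y) + g([X,Y],Z) - g([X,Z],Y) - g([Y,Z],X)`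
of three vector fields, which equals `2 g(∇̂_X Y, Z)` for the Levi-Civita connection. -/
def koszul (X Y Z : Π x : M, TangentSpace I x) (x : M) : ℝ :=
  mvfderiv I (fun y => inner ℝ (Y y) (Z y)) x (X x)
    + mvfderiv I (fun y => inner ℝ (Z y) (X y)) x (Y x)
    - mvfderiv I (fun y => inner ℝ (X y) (Y y)) x (Z x)
    + inner ℝ (mlieBracket I X Y x) (Z x)
    - inner ℝ (mlieBracket I X Z x) (Y x)
    - inner ℝ (mlieBracket I Y Z x) (X x)

lemma mvfderiv_inner_comm {X Y : Π x : M, TangentSpace I x} {x : M} :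
    mvfderiv I (fun y => (inner ℝ (X y) (Y y) : ℝ)) x
      = mvfderiv I (fun y => (inner ℝ (Y y) (X y) : ℝ)) x := by
  simp only [real_inner_comm]

variable [IsContMDiffRiemannianBundle I ∞ E (fun x : M => TangentSpace I x)]
  {X Y Z X' Y' Z' : Π x : M, TangentSpace I x} {x : M} {f : M → ℝ}

lemma mdiffAt_inner (hY : MDiffAt (T% Y) x) (hZ : MDiffAt (T% Z) x) :
    MDiffAt (fun y => (inner ℝ (Y y) (Z y) : ℝ)) x :=
  MDifferentiableAt.inner_bundle (IB := I) (F := E) (E := fun x : M => TangentSpace I x) hY hZ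

lemma mvfderiv_inner_add_left (hX : MDiffAt (T% X) x) (hX' : MDiffAt (T% X') x)
    (hY : MDiffAt (T% Y) x) :
    mvfderiv I (fun y => (inner ℝ ((X + X') y) (Y y) : ℝ)) x
      = mvfderiv I (fun y => (inner ℝ (X y) (Y y) : ℝ)) x
        + mvfderiv I (fun y => (inner ℝ (X' y) (Y y) : ℝ)) x := by
  rw [← mvfderiv_fun_add (mdiffAt_inner hX hY) (mdiffAt_inner hX' hY)]
  simp only [Pi.add_apply, inner_add_left]

lemma mvfderiv_inner_add_right (hX : MDiffAt (T% X) x) (hX' : MDiffAt (T% X') x)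
    (hY : MDiffAt (T% Y) x) :
    mvfderiv I (fun y => (inner ℝ (Y y) ((X + X') y) : ℝ)) x
      = mvfderiv I (fun y => (inner ℝ (Y y) (X y) : ℝ)) x
        + mvfderiv I (fun y => (inner ℝ (Y y) (X' y) : ℝ)) x := by
  rw [mvfderiv_inner_comm, mvfderiv_inner_add_left hX hX' hY, mvfderiv_inner_comm (X := X),
    mvfderiv_inner_comm (X := X')]

lemma mvfderiv_inner_smul_left (hf : MDiffAt f x) (hX : MDiffAt (T% X) x)
    (hY : MDiffAt (T% Y) x) (v : TangentSpace I x) :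
    mvfderiv I (fun y => (inner ℝ ((f • X) y) (Y y) : ℝ)) x v
      = f x * mvfderiv I (fun y => (inner ℝ (X y) (Y y) : ℝ)) x v
        + inner ℝ (X x) (Y x) * mvfderiv I f x v := by
  have h := mvfderiv_fun_mul hf (mdiffAt_inner hX hY)
  have h2 : (fun y => (inner ℝ ((f • X) y) (Y y) : ℝ))
      = fun y => f y * (inner ℝ (X y) (Y y) : ℝ) := by
    funext y
    simp only [Pi.smul_apply', real_inner_smul_left]
  rw [h2, h]
  simp

lemma mvfderiv_inner_smul_right (hf : MDiffAt f x) (hX : MDiffAt (T% X) x)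
    (hY : MDiffAt (T% Y) x) (v : TangentSpace I x) :
    mvfderiv I (fun y => (inner ℝ (Y y) ((f • X) y) : ℝ)) x v
      = f x * mvfderiv I (fun y => (inner ℝ (Y y) (X y) : ℝ)) x v
        + inner ℝ (Y x) (X x) * mvfderiv I f x v := by
  rw [mvfderiv_inner_comm, mvfderiv_inner_smul_left hf hX hY, mvfderiv_inner_comm (X := X),
    real_inner_comm]

end InnerDeriv

section LeviCivita

variable {E : Type*} [NormedAddCommGroup E] [NormedSpace ℝ E] [FiniteDimensional ℝ E]
  {H : Type*} [TopologicalSpace H] {I : ModelWithCorners ℝ E H}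
  {M : Type*} [TopologicalSpace M] [ChartedSpace H M] [IsManifold I ∞ M]
  [RiemannianBundle (fun x : M => TangentSpace I x)]
  [IsContMDiffRiemannianBundle I ∞ E (fun x : M => TangentSpace I x)]
  {X Y Z X' Y' Z' : Π x : M, TangentSpace I x} {x : M} {f : M → ℝ}

instance finiteDimensional_tangentSpace (x : M) : FiniteDimensional ℝ (TangentSpace I x) :=
  inferInstanceAs (FiniteDimensional ℝ E)

lemma koszul_tensorial_left (hY : MDiffAt (T% Y) x) (hZ : MDiffAt (T% Z) x) :
    TensorialAt I E (fun X : Π x : M, TangentSpace I x => koszul X Y Z x) x where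
  smul {f X} hf hX := by
    have := FiniteDimensional.complete ℝ E
    simp only [koszul, mvfderiv_inner_smul_left hf hX hY, mvfderiv_inner_smul_right hf hX hZ]
    simp only [mlieBracket_smul_left hf hX, inner_add_left, inner_smul_left, inner_smul_right,
      Pi.smul_apply', map_smul, smul_eq_mul, RCLike.conj_to_real]
    simp [real_inner_comm]
    ring
  add {X X'} hX hX' := by
    have := FiniteDimensional.complete ℝ E
    simp only [koszul, mvfderiv_inner_add_left hX hX' hY, mvfderiv_inner_add_right hX hX' hZ]
    simp only [mlieBracket_add_left hX hX', inner_add_left, inner_add_right, Pi.add_apply, map_add,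
      add_apply]
    ring

lemma koszul_tensorial_right (hX : MDiffAt (T% X) x) (hY : MDiffAt (T% Y) x) :
    TensorialAt I E (fun Z : Π x : M, TangentSpace I x => koszul X Y Z x) x where
  smul {f Z} hf hZ := by
    have := FiniteDimensional.complete ℝ E
    simp only [koszul, mvfderiv_inner_smul_left hf hZ hX, mvfderiv_inner_smul_right hf hZ hY]
    simp only [mlieBracket_smul_right hf hZ, inner_add_left, inner_smul_left, inner_smul_right,
      Pi.smul_apply', map_smul, smul_eq_mul, RCLike.conj_to_real]
    simp [real_inner_comm]
    ring
  add {Z Z'} hZ hZ' := by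
    have := FiniteDimensional.complete ℝ E
    simp only [koszul, mvfderiv_inner_add_left hZ hZ' hX, mvfderiv_inner_add_right hZ hZ' hY]
    simp only [mlieBracket_add_right hZ hZ', inner_add_left, inner_add_right, Pi.add_apply, map_add,
      add_apply]
    ring

lemma koszul_add_mid (hX : MDiffAt (T% X) x) (hY : MDiffAt (T% Y) x) (hY' : MDiffAt (T% Y') x)
    (hZ : MDiffAt (T% Z) x) : koszul X (Y + Y') Z x = koszul X Y Z x + koszul X Y' Z x := by
  have := FiniteDimensional.complete ℝ E
  simp only [koszul, mvfderiv_inner_add_left hY hY' hZ, mvfderiv_inner_add_right hY hY' hX]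
  simp only [mlieBracket_add_right hY hY', mlieBracket_add_left hY hY', inner_add_left, inner_add_right,
    Pi.add_apply, map_add, add_apply]
  ring

lemma koszul_smul_mid (hf : MDiffAt f x) (hX : MDiffAt (T% X) x) (hY : MDiffAt (T% Y) x)
    (hZ : MDiffAt (T% Z) x) :
    koszul X (f • Y) Z x
      = f x * koszul X Y Z x + 2 * (mvfderiv I f x (X x) * inner ℝ (Y x) (Z x)) := by
  have := FiniteDimensional.complete ℝ E
  simp only [koszul, mvfderiv_inner_smul_left hf hY hZ, mvfderiv_inner_smul_right hf hY hX]
  simp only [mlieBracket_smul_right hf hY, mlieBracket_smul_left hf hY, inner_add_left, inner_smul_left,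
    inner_smul_right, Pi.smul_apply', map_smul, smul_eq_mul, RCLike.conj_to_real]
  simp [real_inner_comm]
  ring

/-- For fixed `Y`, the Koszul expression as a bilinear form in the values of `X` and `Z` at `x`. -/
def koszulForm (hY : MDiffAt (T% Y) x) :
    TangentSpace I x →L[ℝ] TangentSpace I x →L[ℝ] ℝ :=
  TensorialAt.mkHom₂ (I := I) (F := E) (F' := E) (V := fun x : M => TangentSpace I x)
    (V' := fun x : M => TangentSpace I x) (fun X Z => koszul X Y Z x) x
    (fun _ hZ => koszul_tensorial_left hY hZ) (fun _ hX => koszul_tensorial_right hX hY)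

lemma koszulForm_apply (hX : MDiffAt (T% X) x) (hY : MDiffAt (T% Y) x) (hZ : MDiffAt (T% Z) x) :
    koszulForm hY (X x) (Z x) = koszul X Y Z x :=
  TensorialAt.mkHom₂_apply (I := I) (F := E) (F' := E) (V := fun x : M => TangentSpace I x)
    (V' := fun x : M => TangentSpace I x) _ _ hX hZ

open scoped Classical in
/-- The operator `Y ↦ (X ↦ ∇̂_X Y)` determined by the Koszul formula (set to `0` at the points where
`Y` is not differentiable). -/
def leviCivitaAux (Y : Π x : M, TangentSpace I x) (x : M) :
    TangentSpace I x →L[ℝ] TangentSpace I x :=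
  if hY : MDiffAt (T% Y) x then
    ∑ i, ((1 / 2 : ℝ) • (koszulForm hY).flip (stdOrthonormalBasis ℝ (TangentSpace I x) i)).smulRight
      (stdOrthonormalBasis ℝ (TangentSpace I x) i)
  else 0

lemma inner_leviCivitaAux' (hY : MDiffAt (T% Y) x) (v w : TangentSpace I x) :
    inner ℝ (leviCivitaAux Y x v) w = 1 / 2 * koszulForm hY v w := by
  set b := stdOrthonormalBasis ℝ (TangentSpace I x) with hb
  have h : w = ∑ i, inner ℝ (b i) w • b i := (b.sum_repr' w).symm
  conv_rhs => rw [h]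
  simp only [leviCivitaAux, hY, dite_true, sum_apply, sum_inner,
    ContinuousLinearMap.smulRight_apply, inner_smul_left, map_sum, map_smul, Finset.mul_sum,
    smul_apply, ContinuousLinearMap.flip_apply, smul_eq_mul, ← hb,
    RCLike.conj_to_real]
  exact Finset.sum_congr rfl fun i _ => by ring

lemma inner_leviCivitaAux (hX : MDiffAt (T% X) x) (hY : MDiffAt (T% Y) x)
    (hZ : MDiffAt (T% Z) x) :
    inner ℝ (leviCivitaAux Y x (X x)) (Z x) = 1 / 2 * koszul X Y Z x := by
  rw [inner_leviCivitaAux' hY, koszulForm_apply hX hY hZ]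

/-- Endomorphisms of a tangent space are equal if their inner products against differentiable
vector fields are. -/
lemma ext_extend {v v' : TangentSpace I x →L[ℝ] TangentSpace I x}
    (h : ∀ X Z : Π x : M, TangentSpace I x, MDiffAt (T% X) x → MDiffAt (T% Z) x →
      (inner ℝ (v (X x)) (Z x) : ℝ) = inner ℝ (v' (X x)) (Z x)) : v = v' := by
  ext1 a
  refine ext_inner_right ℝ fun w => ?_
  simpa using h (FiberBundle.extend E a) (FiberBundle.extend E w)
    (FiberBundle.mdifferentiableAt_extend I E a) (FiberBundle.mdifferentiableAt_extend I E w)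

variable (I M) in
/-- The Levi-Civita connection `∇̂` of the Riemannian metric; `leviCivita I M Y x v` is `∇̂_v Y`. -/
def leviCivita : CovariantDerivative I E (fun x : M => TangentSpace I x) where
  toFun := leviCivitaAux
  isCovariantDerivativeOnUniv :=
    { add := by
        intro Y Y' x hY hY' _
        refine ext_extend fun X Z hX hZ => ?_
        rw [add_apply, inner_add_left,
          inner_leviCivitaAux hX (mdifferentiableAt_add_section hY hY') hZ,
          inner_leviCivitaAux hX hY hZ, inner_leviCivitaAux hX hY' hZ, koszul_add_mid hX hY hY' hZ]
        ring
      leibniz := by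
        intro Y f x hY hf _
        refine ext_extend fun X Z hX hZ => ?_
        rw [add_apply, inner_add_left,
          inner_leviCivitaAux hX (hf.smul_section hY) hZ, koszul_smul_mid hf hX hY hZ,
          smul_apply, inner_smul_left, inner_leviCivitaAux hX hY hZ,
          ContinuousLinearMap.smulRight_apply, inner_smul_left]
        simp only [RCLike.conj_to_real]
        ring }

theorem leviCivita_torsion : (leviCivita I M).torsion = 0 := by
  have := FiniteDimensional.complete ℝ E
  rw [CovariantDerivative.torsion_eq_zero_iff]
  intro X Y x hX hY
  refine ext_inner_right ℝ fun w => ?_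
  have hw : w = FiberBundle.extend E w x := by simp
  have hZ := FiberBundle.mdifferentiableAt_extend I E w
  rw [hw, inner_sub_left]
  erw [inner_leviCivitaAux hX hY hZ, inner_leviCivitaAux hY hX hZ]
  rw [koszul, koszul, mlieBracket_swap_apply (V := Y) (W := X)]
  simp [real_inner_comm]
  ring

theorem leviCivita_isMetricCompatible : 
    CovariantDerivative.IsMetricCompatible (V := fun x : M => TangentSpace I x) (leviCivita I M) := by
  have := FiniteDimensional.complete ℝ E
  rw [CovariantDerivative.isMetricCompatible_iff]
  intro x X Y Z hX hY hZ
  dsimp only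
  rw [real_inner_comm _ (Y x)]
  erw [inner_leviCivitaAux hX hY hZ, inner_leviCivitaAux hX hZ hY]
  rw [koszul, koszul, mlieBracket_swap_apply (V := Z) (W := Y)]
  simp [real_inner_comm]
  ring

end LeviCivita

section Statistical

variable {E : Type*} [NormedAddCommGroup E] [NormedSpace ℝ E] [FiniteDimensional ℝ E]
  {H : Type*} [TopologicalSpace H] {I : ModelWithCorners ℝ E H}
  {M : Type*} [TopologicalSpace M] [ChartedSpace H M] [IsManifold I ∞ M]
  [RiemannianBundle (fun x : M => TangentSpace I x)]
  [IsContMDiffRiemannianBundle I ∞ E (fun x : M => TangentSpace I x)]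

/-- The covariant derivative of the metric,
`(∇_X g)(Y, Z) = X g(Y, Z) - g(∇_X Y, Z) - g(Y, ∇_X Z)`. -/
def nablaMetric (nab : CovariantDerivative I E (fun x : M => TangentSpace I x)) (x : M)
    (X Y Z : TangentSpace I x) : ℝ :=
  CovariantDerivative.derivMetricTensor (V := fun x : M => TangentSpace I x) nab x Y Z X

theorem nablaMetric_apply (nab : CovariantDerivative I E (fun x : M => TangentSpace I x)) {x : M}
    {X Y Z : Π x : M, TangentSpace I x} (hY : MDiffAt (T% Y) x) (hZ : MDiffAt (T% Z) x) :
    nablaMetric nab x (X x) (Y x) (Z x)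
      = mvfderiv I (fun y => (inner ℝ (Y y) (Z y) : ℝ)) x (X x)
        - inner ℝ (nab Y x (X x)) (Z x) - inner ℝ (Y x) (nab Z x (X x)) := by
  unfold nablaMetric
  have h := CovariantDerivative.derivMetricTensor_apply (V := fun x : M => TangentSpace I x) nab x
    (X := X) (σ := Y) (τ := Z) hY hZ
  rw [h]

/-- `(g, ∇)` is a statistical structure: `∇` is a smooth torsion-free connection and the cubic form
`∇g` is symmetric (its symmetry in the last two arguments is automatic). -/
structure IsStatistical (nab : CovariantDerivative I E (fun x : M => TangentSpace I x)) : Prop where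
  smooth : CovariantDerivative.ContMDiffCovariantDerivative nab ∞
  torsion_free : nab.torsion = 0
  symmetric : ∀ (x : M) (X Y Z : TangentSpace I x),
    nablaMetric nab x X Y Z = nablaMetric nab x Y X Z

/-- The cubic form `A = -(1/2) ∇g`. -/
def cubicForm (nab : CovariantDerivative I E (fun x : M => TangentSpace I x)) (x : M)
    (X Y Z : TangentSpace I x) : ℝ :=
  -(1 / 2) * nablaMetric nab x X Y Z

/-- `A(X, Y, Z) = g(K(X, Y), Z)` with the difference tensor `K(X, Y) = ∇_X Y - ∇̂_X Y`. -/
theorem cubicForm_eq (nab : CovariantDerivative I E (fun x : M => TangentSpace I x))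
    (h : IsStatistical nab) {x : M} {X Y Z : Π x : M, TangentSpace I x}
    (hX : MDiffAt (T% X) x) (hY : MDiffAt (T% Y) x) (hZ : MDiffAt (T% Z) x) :
    cubicForm nab x (X x) (Y x) (Z x)
      = inner ℝ (nab Y x (X x) - leviCivita I M Y x (X x)) (Z x) := by
  have := FiniteDimensional.complete ℝ E
  have t {X Y : Π x : M, TangentSpace I x} (a : MDiffAt (T% X) x) (b : MDiffAt (T% Y) x) :=
    (CovariantDerivative.torsion_eq_zero_iff nab).1 h.torsion_free a b
  have e : inner ℝ (leviCivita I M Y x (X x)) (Z x) = 1 / 2 * koszul X Y Z x :=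
    inner_leviCivitaAux hX hY hZ
  have a1 := nablaMetric_apply nab (X := X) hY hZ
  have a2 := nablaMetric_apply nab (X := Y) hZ hX
  have a3 := nablaMetric_apply nab (X := Z) hX hY
  have s1 := h.symmetric x (X x) (Y x) (Z x)
  have a4 := nablaMetric_apply nab (X := Y) hX hZ
  have s2 := h.symmetric x (X x) (Z x) (Y x)
  have a5 := nablaMetric_apply nab (X := X) hZ hY
  rw [inner_sub_left, e, koszul, ← t hX hY, ← t hX hZ, ← t hY hZ, cubicForm]
  simp only [inner_sub_left, real_inner_comm] at *
  linarith

variable (I) in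
/-- A `g`-orthonormal basis of the tangent space at `x`. The traces and squared norms below do not
depend on its choice. -/
def onb (x : M) : OrthonormalBasis (Fin (Module.finrank ℝ (TangentSpace I x))) ℝ
    (TangentSpace I x) :=
  stdOrthonormalBasis ℝ (TangentSpace I x)

/-- The Czebyshev form `τ(X) = tr_g A(X, ·, ·)`. -/
def czebyshev (nab : CovariantDerivative I E (fun x : M => TangentSpace I x)) (x : M)
    (X : TangentSpace I x) : ℝ :=
  ∑ i, cubicForm nab x X (onb I x i) (onb I x i)

/-- The structure is trace-free: `τ = 0`. -/
def IsTraceFree (nab : CovariantDerivative I E (fun x : M => TangentSpace I x)) : Prop :=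
  ∀ (x : M) (X : TangentSpace I x), czebyshev nab x X = 0

/-- The curvature `R(X, Y)Z = ∇_X ∇_Y Z - ∇_Y ∇_X Z - ∇_[X,Y] Z` of a connection. -/
def curvature (nab : CovariantDerivative I E (fun x : M => TangentSpace I x))
    (X Y Z : Π x : M, TangentSpace I x) (x : M) : TangentSpace I x :=
  nab (fun y => nab Z y (Y y)) x (X x) - nab (fun y => nab Z y (X y)) x (Y x)
    - nab Z x (mlieBracket I X Y x)

/-- `R = h R₀`, where `R₀(X, Y)Z = g(Y, Z) X - g(X, Z) Y` and `h` is a function. -/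
def HasCurvature (nab : CovariantDerivative I E (fun x : M => TangentSpace I x)) (h : M → ℝ) :
    Prop :=
  ∀ X Y Z : Π x : M, TangentSpace I x, CMDiff ∞ (T% X) → CMDiff ∞ (T% Y) → CMDiff ∞ (T% Z) →
    ∀ x : M, curvature nab X Y Z x
      = h x • ((inner ℝ (Y x) (Z x) : ℝ) • X x - (inner ℝ (X x) (Z x) : ℝ) • Y x)

/-- `‖A‖²`. -/
def normSqCubicForm (nab : CovariantDerivative I E (fun x : M => TangentSpace I x)) (x : M) : ℝ :=
  ∑ i, ∑ j, ∑ k, cubicForm nab x (onb I x i) (onb I x j) (onb I x k) ^ 2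

/-- The derivative of the cubic form `A` with respect to the Levi-Civita connection, on vector
fields: `(∇̂_X A)(Y, Z, W) = X(A(Y, Z, W)) - A(∇̂_X Y, Z, W) - A(Y, ∇̂_X Z, W) - A(Y, Z, ∇̂_X W)`. -/
def covDerivCubicForm (nab : CovariantDerivative I E (fun x : M => TangentSpace I x))
    (X Y Z W : Π x : M, TangentSpace I x) (x : M) : ℝ :=
  mvfderiv I (fun y => cubicForm nab y (Y y) (Z y) (W y)) x (X x)
    - cubicForm nab x (leviCivita I M Y x (X x)) (Z x) (W x)
    - cubicForm nab x (Y x) (leviCivita I M Z x (X x)) (W x)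
    - cubicForm nab x (Y x) (Z x) (leviCivita I M W x (X x))

/-- `‖∇̂A‖²`. The tensor `∇̂A` is evaluated on tangent vectors at `x` by extending them to vector
fields which are smooth near `x`. -/
def normSqCovDerivCubicForm (nab : CovariantDerivative I E (fun x : M => TangentSpace I x))
    (x : M) : ℝ :=
  ∑ i, ∑ j, ∑ k, ∑ l, covDerivCubicForm nab (FiberBundle.extend E (onb I x i))
    (FiberBundle.extend E (onb I x j)) (FiberBundle.extend E (onb I x k))
    (FiberBundle.extend E (onb I x l)) x ^ 2

variable (I) in
/-- The Hessian `(∇̂²f)(X, Y) = X(Y f) - (∇̂_X Y) f` of a function, on vector fields. -/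
def hessian (f : M → ℝ) (X Y : Π x : M, TangentSpace I x) (x : M) : ℝ :=
  mvfderiv I (fun y => mvfderiv I f y (Y y)) x (X x) - mvfderiv I f x (leviCivita I M Y x (X x))

variable (I) in
/-- The Laplacian `Δf = tr_g ∇̂²f` of a function. -/
def laplacian (f : M → ℝ) (x : M) : ℝ :=
  ∑ i, hessian I f (FiberBundle.extend E (onb I x i)) (FiberBundle.extend E (onb I x i)) x

end Statistical

end

end StatGeom

/-! The theorem is a Bochner formula combined with two algebraic bounds for a single cubic form. In
an orthonormal frame let `Aᵢ` be the symmetric matrix of `A(eᵢ, ·, ·)` and put `q(A) = ∑ ‖[Aᵢ, Aⱼ]‖²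
+ ∑ (tr Aᵢ Aⱼ)²` (`cubicQuartic`). Then `½ Δu = ‖∇̂A‖² + (n + 1) H u + q(A)`
(`laplacian_normSqCubicForm`), so what remains is `(n + 1) / (n (n - 1)) u² ≤ q(A) ≤ 3/2 u²`. For `n
= 2` the two constants agree, which forces equality.

Bochner formula. The connection matrices of `∇` are `W + A`, with `W` the skew matrices of `∇̂` and
`A` symmetric. Since `R = H R₀`, the curvature matrices of `∇` are skew. Their symmetric part is the
Codazzi expression, so `∇̂A` is totally symmetric; their skew part is the Gauss equation `R̂ = R +
[A, A]` (`codazzi_gauss`). By Codazzi and the Ricci identity, `∑ ∇²_{a,a} A_{jkl} = ∑ ∇²_{a,j}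
A_{akl}` equals a divergence, which vanishes by trace-freeness, minus a curvature term
(`sum_secondCovD_eq`). Pairing this with `A` and inserting the Gauss equation gives `(n + 1) H u +
q(A)` (`curvature_contraction`). `H` enters only through its values and is never differentiated, so
no regularity of it is needed.

Upper bound (`sum_commutator_le`). After a rotation of the family the matrices are pairwise
trace-orthogonal. Diagonalising one of them weights the entries of the others by `(λᵢ - λⱼ)²`; only
few of these weights exceed `∑ λ²` (`sum_large_gap_le`), and Bessel's inequality controls the
entries they multiply.

Lower bound (`le_cubicQuartic`). The two sums are bounded separately by Cauchy–Schwarz: the Gram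
matrix against its diagonal, the commutators against the curvature tensor of the unit sphere.

The differential calculus is carried out over an abstract commutative ℝ-algebra with derivations,
then applied to functions on an open set that carries an orthonormal frame. Tensoriality exchanges
the frame for the vector extensions used in the definitions. -/

namespace StatGeom

/-! ### Commutator inequalities for families of symmetric matrices. -/

section MatrixInequalities

open Matrix

variable {ι κ : Type*} [Fintype ι]

/-- The squared Frobenius norm of a matrix. -/
def frobSq (X : Matrix ι ι ℝ) : ℝ := ∑ i, ∑ j, X i j ^ 2

lemma frobSq_nonneg (X : Matrix ι ι ℝ) : 0 ≤ frobSq X :=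
  Finset.sum_nonneg fun _ _ => Finset.sum_nonneg fun _ _ => sq_nonneg _

lemma frobSq_eq_trace (X : Matrix ι ι ℝ) : frobSq X = (Xᵀ * X).trace := by
  simp only [frobSq, Matrix.trace, Matrix.diag, Matrix.mul_apply, Matrix.transpose_apply, sq]
  exact Finset.sum_comm

lemma frobSq_conj [DecidableEq ι] {U : Matrix ι ι ℝ} (hU : U * Uᵀ = 1) (X : Matrix ι ι ℝ) :
    frobSq (Uᵀ * X * U) = frobSq X := by
  rw [frobSq_eq_trace, frobSq_eq_trace]
  simp only [Matrix.transpose_mul, Matrix.transpose_transpose]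
  calc (Uᵀ * (Xᵀ * U) * (Uᵀ * X * U)).trace
      = (Uᵀ * (Xᵀ * (U * Uᵀ) * X * U)).trace := by simp only [Matrix.mul_assoc]
    _ = _ := by rw [hU, Matrix.mul_one, Matrix.trace_mul_comm, Matrix.mul_assoc _ U, hU,
        Matrix.mul_one]

/-- The terms `(λᵢ - λⱼ)² - ∑ λ²` with a common index `i` sum to at most `∑ λ²`. -/
lemma sum_star_le [DecidableEq ι] (l : ι → ℝ) (i : ι) (J : Finset ι) (hi : i ∉ J) :
    ∑ j ∈ J, ((l i - l j) ^ 2 - ∑ k, l k ^ 2) ≤ ∑ k, l k ^ 2 := by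
  set N := ∑ k, l k ^ 2
  have hN : l i ^ 2 + ∑ j ∈ J, l j ^ 2 ≤ N := by
    rw [← Finset.sum_insert (f := fun k => l k ^ 2) hi]
    exact Finset.sum_le_univ_sum_of_nonneg fun _ => sq_nonneg _
  have hcs : (∑ j ∈ J, l j) ^ 2 ≤ J.card * ∑ j ∈ J, l j ^ 2 := sq_sum_le_card_mul_sum_sq
  have hs : ∑ j ∈ J, ((l i - l j) ^ 2 - N)
      = J.card * l i ^ 2 - 2 * l i * ∑ j ∈ J, l j + ∑ j ∈ J, l j ^ 2 - J.card * N := by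
    simp only [sub_sq, Finset.sum_sub_distrib, Finset.sum_add_distrib, Finset.sum_const,
      nsmul_eq_mul, Finset.mul_sum]
  rw [hs]
  have h0 : (0 : ℝ) ≤ J.card := Nat.cast_nonneg _
  -- After `hN` and Cauchy–Schwarz, the left side minus the right is at most `-(λᵢ + ∑_J λⱼ)²`.
  nlinarith [sq_nonneg (l i + ∑ j ∈ J, l j), mul_le_mul_of_nonneg_left hN h0]

/-- If both `(i, j)` and `(i', j')` satisfy `(λᵢ - λⱼ)² > ∑ λ²`, `λᵢ > λⱼ`, then `i = i'` or
`j = j'`. -/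
lemma large_gap_intersect [DecidableEq ι] (l : ι → ℝ) {i j i' j' : ι} (h : l j < l i)
    (h' : l j' < l i') (hl : ∑ k, l k ^ 2 < (l i - l j) ^ 2)
    (hl' : ∑ k, l k ^ 2 < (l i' - l j') ^ 2) : i = i' ∨ j = j' := by
  by_contra! hne
  have hle (s : Finset ι) : ∑ k ∈ s, l k ^ 2 ≤ ∑ k, l k ^ 2 :=
    Finset.sum_le_univ_sum_of_nonneg fun _ => sq_nonneg _
  have pair {a b : ι} (hab : l b < l a) (hlab : ∑ k, l k ^ 2 < (l a - l b) ^ 2) :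
      0 < l a ∧ l b < 0 := by
    have hab' : a ≠ b := fun e => by simp [e] at hab
    have := hle {a, b}
    rw [Finset.sum_pair hab'] at this
    -- Expanding `λₐ² + λ_b² < (λₐ - λ_b)²` leaves only the cross term, so a large gap joins a
    -- positive and a negative entry. This also rules out `i = j'` and `j = i'`.
    have hp : l a * l b < 0 := by nlinarith
    rcases mul_neg_iff.1 hp with h | h
    · exact h
    · linarith
  obtain ⟨p1, p2⟩ := pair h hl
  obtain ⟨p3, p4⟩ := pair h' hl'
  have e1 : i ≠ j := fun e => by simp [e] at h
  have e2 : i' ≠ j' := fun e => by simp [e] at h'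
  have e3 : i ≠ j' := fun e => by rw [e] at p1; linarith
  have e4 : j ≠ i' := fun e => by rw [e] at p2; linarith
  have := hle {i, j, i', j'}
  rw [Finset.sum_insert (by simp [e1, hne.1, e3]), Finset.sum_insert (by simp [e4, hne.2]),
    Finset.sum_pair e2] at this
  -- With four distinct indices, the two gaps squared add to at most twice the sum of the four
  -- squares, hence to at most `2 ∑ λ²`, although each exceeds `∑ λ²`.
  nlinarith [sq_nonneg (l i + l j), sq_nonneg (l i' + l j')]

/-- The pairs with `λᵢ > λⱼ` and positive excess meet pairwise in a first or a second entry
(`large_gap_intersect`), hence all share one entry, and `sum_star_le` bounds their total by `∑ λ²`.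
The factor 2 accounts for the two orders of a pair. -/
lemma sum_large_gap_le [DecidableEq ι] (l : ι → ℝ) :
    ∑ i, ∑ j, max ((l i - l j) ^ 2 - ∑ k, l k ^ 2) 0 ≤ 2 * ∑ k, l k ^ 2 := by
  set N := ∑ k, l k ^ 2 with hNdef
  have hN0 : 0 ≤ N := Finset.sum_nonneg fun _ _ => sq_nonneg _
  set m : ι → ι → ℝ := fun i j => max ((l i - l j) ^ 2 - N) 0 with hm
  have hsym (i j) : m i j = m j i := by simp only [hm]; rw [← neg_sub (l i), neg_sq]
  have hsplit (i j) : m i j = (if l j < l i then m i j else 0) + if l i < l j then m j i else 0 := by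
    rcases lt_trichotomy (l i) (l j) with h | h | h
    · simp [h, h.le, hsym i j]
    · simp [hm, h, hN0]
    · simp [h, h.le]
  have h2 : ∑ i, ∑ j, m i j = 2 * ∑ i, ∑ j, if l j < l i then m i j else 0 := by
    rw [two_mul]
    conv_lhs => enter [2, i, 2, j]; rw [hsplit i j]
    simp only [Finset.sum_add_distrib]
    congr 1
    exact Finset.sum_comm
  rw [h2]
  refine mul_le_mul_of_nonneg_left ?_ zero_le_two
  set L : Finset (ι × ι) :=
    Finset.univ.filter fun p => l p.2 < l p.1 ∧ N < (l p.1 - l p.2) ^ 2 with hL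
  have hmem (p : ι × ι) : p ∈ L ↔ l p.2 < l p.1 ∧ N < (l p.1 - l p.2) ^ 2 := by simp [hL]
  have hsum : (∑ i, ∑ j, if l j < l i then m i j else 0)
      = ∑ p ∈ L, ((l p.1 - l p.2) ^ 2 - N) := by
    rw [← Finset.sum_product', Finset.univ_product_univ, hL, Finset.sum_filter]
    refine Finset.sum_congr rfl fun p _ => ?_
    by_cases h1 : l p.2 < l p.1 <;> by_cases h3 : N < (l p.1 - l p.2) ^ 2
    · simp [h1, h3, hm, h3.le]
    · simp [h1, h3, hm, not_lt.1 h3]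
    · simp [h1]
    · simp [h1]
  rw [hsum]
  have hint {p q : ι × ι} (hp : p ∈ L) (hq : q ∈ L) : p.1 = q.1 ∨ p.2 = q.2 :=
    large_gap_intersect l ((hmem p).1 hp).1 ((hmem q).1 hq).1 ((hmem p).1 hp).2 ((hmem q).1 hq).2
  rcases L.eq_empty_or_nonempty with h | ⟨p, hp⟩
  · simpa [h] using hN0
  -- If some `q` differs from `p` in the first entry, it agrees with `p` in the second; a further
  -- pair must meet both `p` and `q`, so it has the same second entry.
  by_cases hstar : ∀ q ∈ L, q.1 = p.1
  · have : ∑ q ∈ L, ((l q.1 - l q.2) ^ 2 - N)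
        = ∑ j ∈ L.image Prod.snd, ((l p.1 - l j) ^ 2 - N) := by
      rw [Finset.sum_image]
      · exact Finset.sum_congr rfl fun q hq => by rw [hstar q hq]
      · intro q hq r hr h
        exact Prod.ext ((hstar q hq).trans (hstar r hr).symm) h
    rw [this]
    refine sum_star_le l p.1 _ fun h => ?_
    obtain ⟨q, hq, e⟩ := Finset.mem_image.1 h
    have := ((hmem q).1 hq).1
    rw [e, hstar q hq] at this
    exact lt_irrefl _ this
  · push Not at hstar
    obtain ⟨q, hq, hqp⟩ := hstar
    have hqp2 : q.2 = p.2 := (hint hq hp).resolve_left hqp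
    have hstar' : ∀ r ∈ L, r.2 = p.2 := by
      intro r hr
      by_contra hne
      have h1 := (hint hr hp).resolve_right hne
      have h2 := (hint hr hq).resolve_right (by rwa [hqp2])
      exact hqp (h2.symm.trans h1)
    have : ∑ q ∈ L, ((l q.1 - l q.2) ^ 2 - N)
        = ∑ j ∈ L.image Prod.fst, ((l p.2 - l j) ^ 2 - N) := by
      rw [Finset.sum_image]
      · exact Finset.sum_congr rfl fun q hq => by rw [hstar' q hq]; ring
      · intro q hq r hr h
        exact Prod.ext h ((hstar' q hq).trans (hstar' r hr).symm)
    rw [this]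
    refine sum_star_le l p.2 _ fun h => ?_
    obtain ⟨q, hq, e⟩ := Finset.mem_image.1 h
    have := ((hmem q).1 hq).1
    rw [e, hstar' q hq] at this
    exact lt_irrefl _ this

/-- Bessel's inequality for pairwise orthogonal vectors of squared norm at most `c`. -/
lemma sum_sq_le_of_orthogonal {σ : Type*} [Fintype σ] (s : Finset κ) (B : κ → σ → ℝ) (F : σ → ℝ)
    {c : ℝ} (hc0 : 0 ≤ c) (hc : ∀ β ∈ s, ∑ p, B β p ^ 2 ≤ c)
    (ho : ∀ β ∈ s, ∀ γ ∈ s, β ≠ γ → ∑ p, B β p * B γ p = 0) :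
    ∑ β ∈ s, (∑ p, B β p * F p) ^ 2 ≤ c * ∑ p, F p ^ 2 := by
  classical
  set a : κ → ℝ := fun β => ∑ p, B β p * F p
  set T := ∑ β ∈ s, a β ^ 2
  set G : σ → ℝ := fun p => ∑ β ∈ s, a β * B β p
  have hT0 : 0 ≤ T := Finset.sum_nonneg fun _ _ => sq_nonneg _
  have hTG : T = ∑ p, G p * F p := by
    simp only [T, G, Finset.sum_mul]
    rw [Finset.sum_comm]
    refine Finset.sum_congr rfl fun β _ => ?_
    rw [sq]
    conv_lhs => rw [show a β * a β = a β * ∑ p, B β p * F p from rfl, Finset.mul_sum]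
    exact Finset.sum_congr rfl fun p _ => by ring
  have hG : ∑ p, G p ^ 2 ≤ c * T := by
    have : ∑ p, G p ^ 2 = ∑ β ∈ s, a β ^ 2 * ∑ p, B β p ^ 2 := by
      simp only [G, sq (Finset.sum _ _), Finset.sum_mul_sum]
      rw [Finset.sum_comm]
      refine Finset.sum_congr rfl fun β hβ => ?_
      rw [Finset.sum_comm, Finset.sum_eq_single_of_mem β hβ]
      · rw [Finset.mul_sum]
        exact Finset.sum_congr rfl fun p _ => by ring
      · intro γ hγ hne
        calc ∑ p, a β * B β p * (a γ * B γ p) = a β * a γ * ∑ p, B β p * B γ p := by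
              rw [Finset.mul_sum]
              exact Finset.sum_congr rfl fun p _ => by ring
          _ = 0 := by rw [ho β hβ γ hγ hne.symm, mul_zero]
    rw [this, mul_comm, Finset.sum_mul]
    exact Finset.sum_le_sum fun β hβ => mul_le_mul_of_nonneg_left (hc β hβ) (sq_nonneg _)
  have hcs : T ^ 2 ≤ (∑ p, G p ^ 2) * ∑ p, F p ^ 2 := by
    rw [hTG]
    exact Finset.sum_mul_sq_le_sq_mul_sq _ _ _
  have hF : 0 ≤ ∑ p, F p ^ 2 := Finset.sum_nonneg fun _ _ => sq_nonneg _
  rcases hT0.eq_or_lt with h0 | h0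
  · rw [← h0]
    positivity
  · have : T * T ≤ (c * ∑ p, F p ^ 2) * T := by
      -- With `G = ∑ ⟨B_β, F⟩ B_β`, `T = ⟨G, F⟩` and `‖G‖² ≤ c T` by orthogonality, so `T² ≤ c T
      -- ‖F‖²`; then `T` is cancelled.
      nlinarith [mul_le_mul_of_nonneg_right hG hF]
    exact le_of_mul_le_mul_right this h0

lemma exists_orthogonal_diagonal [DecidableEq ι] {A : Matrix ι ι ℝ} (hA : A.IsSymm) :
    ∃ (U : Matrix ι ι ℝ) (l : ι → ℝ), U * Uᵀ = 1 ∧ Uᵀ * A * U = diagonal l := by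
  have hA' : A.IsHermitian := by
    rw [Matrix.IsHermitian, Matrix.conjTranspose_eq_transpose_of_trivial]; exact hA
  have e : (star (hA'.eigenvectorUnitary : Matrix ι ι ℝ))
      = (hA'.eigenvectorUnitary : Matrix ι ι ℝ)ᵀ := by
    rw [Matrix.star_eq_conjTranspose, Matrix.conjTranspose_eq_transpose_of_trivial]
  have h1 := Unitary.mul_star_self_of_mem hA'.eigenvectorUnitary.2
  have h2 := Unitary.star_mul_self_of_mem hA'.eigenvectorUnitary.2
  have h3 := hA'.spectral_theorem
  rw [Unitary.conjStarAlgAut_apply] at h3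
  rw [e] at h1 h2 
  refine ⟨hA'.eigenvectorUnitary, hA'.eigenvalues, h1, ?_⟩
  rw [e] at h3
  set U := (hA'.eigenvectorUnitary : Matrix ι ι ℝ)
  have h4 := congrArg (fun X => Uᵀ * X * U) h3
  refine h4.trans ?_
  calc _ = Uᵀ * U * diagonal (RCLike.ofReal ∘ hA'.eigenvalues) * (Uᵀ * U) := by
        simp only [Matrix.mul_assoc]
    _ = _ := by rw [h2, Matrix.one_mul, Matrix.mul_one]; rfl

/-- For a symmetric matrix `A` and pairwise orthogonal symmetric matrices `B_β` of squared norm at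
most `c`, `∑ ‖[A, B_β]‖² ≤ ‖A‖² (∑ ‖B_β‖² + c)`. -/
lemma sum_frobSq_commutator_le [DecidableEq ι] {A : Matrix ι ι ℝ} (hA : A.IsSymm) (s : Finset κ)
    {B : κ → Matrix ι ι ℝ} (hB : ∀ β, (B β).IsSymm) {c : ℝ} (hc0 : 0 ≤ c)
    (hc : ∀ β ∈ s, frobSq (B β) ≤ c)
    (ho : ∀ β ∈ s, ∀ γ ∈ s, β ≠ γ → (B β * B γ).trace = 0) :
    ∑ β ∈ s, frobSq (A * B β - B β * A) ≤ frobSq A * (∑ β ∈ s, frobSq (B β) + c) := by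
  obtain ⟨U, l, hU, hUA⟩ := exists_orthogonal_diagonal hA
  set C : κ → Matrix ι ι ℝ := fun β => Uᵀ * B β * U
  have hCs (β) (i j : ι) : C β i j = C β j i := by
    have : (C β)ᵀ = C β := by
      simp only [C, Matrix.transpose_mul, Matrix.transpose_transpose, (hB β).eq, Matrix.mul_assoc]
    exact congrFun (congrFun this j) i
  have hCn (β) : frobSq (C β) = frobSq (B β) := frobSq_conj hU _
  have hmul (X Y : Matrix ι ι ℝ) : Uᵀ * (X * Y) * U = (Uᵀ * X * U) * (Uᵀ * Y * U) := by
    calc _ = Uᵀ * (X * 1 * Y) * U := by rw [Matrix.mul_one]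
      _ = _ := by rw [← hU]; simp only [Matrix.mul_assoc]
  have hcomm (β) : frobSq (A * B β - B β * A) = ∑ i, ∑ j, (l i - l j) ^ 2 * C β i j ^ 2 := by
    rw [← frobSq_conj hU, Matrix.mul_sub, Matrix.sub_mul, hmul, hmul, hUA]
    refine Finset.sum_congr rfl fun i _ => Finset.sum_congr rfl fun j _ => ?_
    rw [Matrix.sub_apply, Matrix.diagonal_mul, Matrix.mul_diagonal]
    ring
  have hN : frobSq A = ∑ k, l k ^ 2 := by
    rw [← frobSq_conj hU, hUA, frobSq]
    refine Finset.sum_congr rfl fun i _ => ?_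
    rw [Finset.sum_eq_single i]
    · simp
    · intro j _ hj
      simp [Matrix.diagonal_apply_ne' _ hj]
    · simp
  have hCo (β γ) : ∑ p : ι × ι, C β p.1 p.2 * C γ p.1 p.2 = (B β * B γ).trace := by
    rw [Fintype.sum_prod_type]
    calc ∑ i, ∑ j, C β i j * C γ i j = (C β * C γ).trace := by
          refine Finset.sum_congr rfl fun i _ => Finset.sum_congr rfl fun j _ => ?_
          rw [hCs γ i j]
      _ = (Uᵀ * (B β * B γ) * U).trace := by rw [hmul]
      _ = _ := by rw [Matrix.trace_mul_comm, ← Matrix.mul_assoc, hU, Matrix.one_mul]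
  set q : ι → ι → ℝ := fun i j => ∑ β ∈ s, C β i j ^ 2
  have hq0 (i j) : 0 ≤ q i j := Finset.sum_nonneg fun _ _ => sq_nonneg _
  -- Bessel against `E_{ij} + E_{ji}`: its squared norm is 2 and its product with the symmetric `C
  -- β` is `2 C β i j`, so `4 q i j ≤ 2 c`.
  have hq (i j) (hij : i ≠ j) : q i j ≤ c / 2 := by
    have hb := sum_sq_le_of_orthogonal s (fun β (p : ι × ι) => C β p.1 p.2)
      (fun p => (if p = (i, j) then 1 else 0) + if p = (j, i) then 1 else 0) hc0
      (fun β hβ => by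
        rw [Fintype.sum_prod_type]; exact (hCn β).trans_le (hc β hβ))
      (fun β hβ γ hγ h => (hCo β γ).trans (ho β hβ γ hγ h))
    have e1 : ∑ p : ι × ι, ((if p = (i, j) then (1 : ℝ) else 0)
        + if p = (j, i) then 1 else 0) ^ 2 = 2 := by
      have hne : (i, j) ≠ (j, i) := fun h => hij (Prod.ext_iff.1 h).1
      have (p : ι × ι) : ((if p = (i, j) then (1 : ℝ) else 0) + if p = (j, i) then 1 else 0) ^ 2
          = (if p = (i, j) then (1 : ℝ) else 0) + if p = (j, i) then 1 else 0 := by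
        by_cases h1 : p = (i, j)
        · subst h1; simp [hne]
        · by_cases h2 : p = (j, i)
          · subst h2; simp [hne.symm]
          · simp [h1, h2]
      simp only [this, Finset.sum_add_distrib, Finset.sum_ite_eq', Finset.mem_univ, if_true]
      norm_num
    have e2 (β) : ∑ p : ι × ι, C β p.1 p.2 * ((if p = (i, j) then (1 : ℝ) else 0)
        + if p = (j, i) then 1 else 0) = 2 * C β i j := by
      simp only [mul_add, mul_ite, mul_one, mul_zero, Finset.sum_add_distrib, Finset.sum_ite_eq',
        Finset.mem_univ, if_true]
      rw [hCs β j i]; ring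
    simp only [e1, e2, mul_pow, ← Finset.mul_sum] at hb
    change 2 ^ 2 * q i j ≤ _ at hb
    linarith
  have hmain : ∑ β ∈ s, frobSq (A * B β - B β * A) = ∑ i, ∑ j, (l i - l j) ^ 2 * q i j := by
    simp only [hcomm, q, Finset.mul_sum]
    rw [Finset.sum_comm]
    exact Finset.sum_congr rfl fun i _ => Finset.sum_comm
  have hsumq : ∑ β ∈ s, frobSq (B β) = ∑ i, ∑ j, q i j := by
    rw [← Finset.sum_congr rfl fun β _ => hCn β]
    simp only [q, frobSq]
    rw [Finset.sum_comm]
    exact Finset.sum_congr rfl fun i _ => Finset.sum_comm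
  rw [hmain, hsumq, hN]
  -- The weight `(λᵢ - λⱼ)²` is at most `∑ λ²` plus its positive excess. Only the excess uses `q ≤ c
  -- / 2`, which is available off the diagonal; on the diagonal the left side is zero.
  have hterm (i j) : (l i - l j) ^ 2 * q i j
      ≤ (∑ k, l k ^ 2) * q i j + max ((l i - l j) ^ 2 - ∑ k, l k ^ 2) 0 * (c / 2) := by
    rcases eq_or_ne i j with rfl | hij
    · have : 0 ≤ ∑ k, l k ^ 2 := Finset.sum_nonneg fun _ _ => sq_nonneg _
      have h1 := mul_nonneg this (hq0 i i)
      have h2 : 0 ≤ max ((l i - l i) ^ 2 - ∑ k, l k ^ 2) 0 * (c / 2) :=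
        mul_nonneg (le_max_right _ _) (by linarith)
      simp only [sub_self, ne_eq, OfNat.ofNat_ne_zero, not_false_eq_true, zero_pow, zero_mul] at *
      linarith
    · have h1 := mul_le_mul_of_nonneg_left (hq i j hij)
        (le_max_right ((l i - l j) ^ 2 - ∑ k, l k ^ 2) 0)
      have h2 := mul_le_mul_of_nonneg_right
        (le_max_left ((l i - l j) ^ 2 - ∑ k, l k ^ 2) 0) (hq0 i j)
      linarith
  calc ∑ i, ∑ j, (l i - l j) ^ 2 * q i j
      ≤ ∑ i, ∑ j, ((∑ k, l k ^ 2) * q i j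
          + max ((l i - l j) ^ 2 - ∑ k, l k ^ 2) 0 * (c / 2)) :=
        Finset.sum_le_sum fun i _ => Finset.sum_le_sum fun j _ => hterm i j
    _ = (∑ k, l k ^ 2) * (∑ i, ∑ j, q i j)
          + (∑ i, ∑ j, max ((l i - l j) ^ 2 - ∑ k, l k ^ 2) 0) * (c / 2) := by
        simp only [Finset.sum_add_distrib, Finset.mul_sum, Finset.sum_mul]
    _ ≤ _ := by
        have := mul_le_mul_of_nonneg_right (sum_large_gap_le l) (by linarith : 0 ≤ c / 2)
        linarith

lemma trace_self_mul {X : Matrix ι ι ℝ} (hX : X.IsSymm) : (X * X).trace = frobSq X := by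
  rw [frobSq_eq_trace, hX.eq]

/-- The inequality of An-Min Li and Jimin Li for pairwise orthogonal symmetric matrices. -/
lemma sum_commutator_le_of_orthogonal [DecidableEq ι] [Fintype κ] {B : κ → Matrix ι ι ℝ}
    (hB : ∀ α, (B α).IsSymm) (ho : ∀ α β, α ≠ β → (B α * B β).trace = 0) :
    ∑ α, ∑ β, frobSq (B α * B β - B β * B α) + ∑ α, frobSq (B α) ^ 2
      ≤ 3 / 2 * (∑ α, frobSq (B α)) ^ 2 := by
  classical
  rcases isEmpty_or_nonempty κ with h | h
  · simp
  obtain ⟨o, ho'⟩ := Finite.exists_max fun α => frobSq (B α)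
  set N : κ → ℝ := fun α => frobSq (B α)
  set S := ∑ α, N α
  have hN0 (α) : 0 ≤ N α := frobSq_nonneg _
  have hsplit (f : κ → ℝ) (α) : ∑ β, f β = ∑ β ∈ Finset.univ.erase α, f β + f α :=
    (Finset.sum_erase_add _ _ (Finset.mem_univ α)).symm
  have herase (α) : ∑ β ∈ Finset.univ.erase α, N β = S - N α := by
    rw [show S = _ from hsplit N α]; ring
  have hbound (α) (c : ℝ) (hc0 : 0 ≤ c) (hc : ∀ β, β ≠ α → N β ≤ c) :
      ∑ β, frobSq (B α * B β - B β * B α) ≤ N α * (S - N α + c) := by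
    have := sum_frobSq_commutator_le (hB α) (Finset.univ.erase α) hB hc0
      (fun β hβ => hc β (Finset.ne_of_mem_erase hβ)) (fun β _ γ _ h => ho β γ h)
    rw [← herase, hsplit _ α, sub_self, show frobSq (0 : Matrix ι ι ℝ) = 0 by simp [frobSq],
      add_zero]
    exact this
  -- The matrix `B o` of largest norm is treated with `c = S - N o`, since each other norm is at
  -- most the sum of all the others; every other matrix is treated with `c = N o`.
  have h0 : ∑ β, frobSq (B o * B β - B β * B o) ≤ N o * (S - N o + (S - N o)) := by
    refine hbound o _ ?_ fun β hβ => ?_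
    · rw [← herase]
      exact Finset.sum_nonneg fun _ _ => hN0 _
    · rw [← herase]
      exact Finset.single_le_sum (f := N) (fun _ _ => hN0 _) (by simp [hβ])
  have h1 : ∑ α ∈ Finset.univ.erase o, ∑ β, frobSq (B α * B β - B β * B α)
      ≤ ∑ α ∈ Finset.univ.erase o, N α * (S - N α + N o) :=
    Finset.sum_le_sum fun α _ => hbound α _ (hN0 o) fun β _ => ho' β
  have h2 : ∑ α ∈ Finset.univ.erase o, N α * (S - N α + N o)
      = (S - N o) * (S + N o) - ∑ α ∈ Finset.univ.erase o, N α ^ 2 := by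
    rw [← herase, Finset.sum_mul, ← Finset.sum_sub_distrib]
    exact Finset.sum_congr rfl fun α _ => by ring
  rw [hsplit _ o, hsplit (fun α => frobSq (B α) ^ 2) o]
  change _ + (∑ α ∈ Finset.univ.erase o, N α ^ 2 + N o ^ 2) ≤ 3 / 2 * S ^ 2
  -- The bounds add up to `S² + 2 S N o - 2 (N o)² = 3/2 S² - 1/2 (S - 2 N o)²`.
  nlinarith [sq_nonneg (S - 2 * N o)]

/-- Rotating both indices conjugates the array by `U`, which preserves its Frobenius norm. It serves
for each matrix entry of the commutators `[B i, B j]`, which are bilinear in the family. -/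
lemma sum_rotate (U : Matrix κ κ ℝ) [Fintype κ] [DecidableEq κ] (hU : U * Uᵀ = 1)
    (X : κ → κ → ℝ) : ∑ α, ∑ β, (∑ i, ∑ j, U i α * U j β * X i j) ^ 2 = ∑ i, ∑ j, X i j ^ 2 := by
  rw [← show frobSq (Matrix.of X) = ∑ i, ∑ j, X i j ^ 2 from rfl, ← frobSq_conj hU]
  refine Finset.sum_congr rfl fun α _ => Finset.sum_congr rfl fun β _ => ?_
  congr 1
  simp only [Matrix.mul_apply, Matrix.transpose_apply, Matrix.of_apply, Finset.sum_mul]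
  rw [Finset.sum_comm]
  exact Finset.sum_congr rfl fun i _ => Finset.sum_congr rfl fun j _ => by ring

/-- The inequality of An-Min Li and Jimin Li. -/
theorem sum_commutator_le [DecidableEq ι] [Fintype κ] [DecidableEq κ] {B : κ → Matrix ι ι ℝ}
    (hB : ∀ α, (B α).IsSymm) :
    ∑ α, ∑ β, frobSq (B α * B β - B β * B α) + ∑ α, ∑ β, (B α * B β).trace ^ 2
      ≤ 3 / 2 * (∑ α, frobSq (B α)) ^ 2 := by
  -- Diagonalising the Gram matrix yields an orthogonal recombination `C` of the family with
  -- vanishing mixed traces; every term of the inequality is invariant under it.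
  set ρ : Matrix κ κ ℝ := Matrix.of fun α β => (B α * B β).trace
  have hρ : ρ.IsSymm := by
    ext α β
    exact Matrix.trace_mul_comm _ _
  obtain ⟨U, l, hU, hUρ⟩ := exists_orthogonal_diagonal hρ
  set C : κ → Matrix ι ι ℝ := fun α => ∑ i, U i α • B i
  have hC (α) : (C α).IsSymm := by
    simp only [C, Matrix.IsSymm, Matrix.transpose_sum, Matrix.transpose_smul, (hB _).eq]
  have hCmul (α β) : C α * C β = ∑ i, ∑ j, (U i α * U j β) • (B i * B j) := by
    simp only [C, Finset.sum_mul_sum, smul_mul_smul_comm]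
  have htr (α β) : (C α * C β).trace = (Uᵀ * ρ * U) α β := by
    simp only [hCmul, Matrix.trace_sum, Matrix.trace_smul, smul_eq_mul, Matrix.mul_apply,
      Matrix.transpose_apply, Finset.sum_mul]
    rw [Finset.sum_comm]
    exact Finset.sum_congr rfl fun i _ => Finset.sum_congr rfl fun j _ => by
      simp only [ρ, Matrix.of_apply]; ring
  have key := sum_commutator_le_of_orthogonal hC fun α β h => by
    rw [htr, hUρ, Matrix.diagonal_apply_ne _ h]
  have hn (α) : frobSq (C α) = l α := by
    rw [← trace_self_mul (hC α), htr, hUρ, Matrix.diagonal_apply_eq]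
  have e1 : ∑ α, frobSq (C α) = ∑ α, frobSq (B α) := by
    calc ∑ α, frobSq (C α) = (Uᵀ * ρ * U).trace := by
          rw [hUρ, Matrix.trace_diagonal]; exact Finset.sum_congr rfl fun α _ => hn α
      _ = ρ.trace := by
          rw [Matrix.trace_mul_comm, ← Matrix.mul_assoc, hU, Matrix.one_mul]
      _ = _ := Finset.sum_congr rfl fun α _ => trace_self_mul (hB α)
  have e2 : ∑ α, frobSq (C α) ^ 2 = ∑ α, ∑ β, (B α * B β).trace ^ 2 := by
    change _ = frobSq ρ
    rw [← frobSq_conj hU, hUρ, frobSq]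
    refine Finset.sum_congr rfl fun α _ => ?_
    rw [Finset.sum_eq_single α]
    · simp [hn]
    · intro j _ hj
      simp [Matrix.diagonal_apply_ne' _ hj]
    · simp
  have e3 : ∑ α, ∑ β, frobSq (C α * C β - C β * C α)
      = ∑ α, ∑ β, frobSq (B α * B β - B β * B α) := by
    have h1 (α β) (k m : ι) : (C α * C β - C β * C α) k m
        = ∑ i, ∑ j, U i α * U j β * (B i * B j - B j * B i) k m := by
      rw [hCmul, hCmul, Finset.sum_comm (f := fun i j => (U i β * U j α) • (B i * B j))]
      simp only [Matrix.sub_apply, Matrix.sum_apply, Matrix.smul_apply, smul_eq_mul,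
        ← Finset.sum_sub_distrib]
      exact Finset.sum_congr rfl fun i _ => Finset.sum_congr rfl fun j _ => by ring
    have h2 (D : κ → κ → Matrix ι ι ℝ) :
        ∑ α, ∑ β, frobSq (D α β) = ∑ k, ∑ m, ∑ α, ∑ β, D α β k m ^ 2 := by
      simp only [frobSq]
      calc _ = ∑ α, ∑ k, ∑ β, ∑ m, D α β k m ^ 2 :=
            Finset.sum_congr rfl fun α _ => Finset.sum_comm
        _ = ∑ k, ∑ α, ∑ m, ∑ β, D α β k m ^ 2 := by
            rw [Finset.sum_comm]
            exact Finset.sum_congr rfl fun k _ => Finset.sum_congr rfl fun α _ => Finset.sum_comm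
        _ = _ := Finset.sum_congr rfl fun k _ => Finset.sum_comm
    rw [h2, h2]
    refine Finset.sum_congr rfl fun k _ => Finset.sum_congr rfl fun m _ => ?_
    simp only [h1]
    exact sum_rotate U hU fun i j => (B i * B j - B j * B i) k m
  rwa [e1, e2, e3] at key

/-! ### Upper and lower bounds for the quartic expression of a cubic form. -/

/-- The quartic expression `∑ ‖[Aᵢ, Aⱼ]‖² + ∑ (tr Aᵢ Aⱼ)²` in the matrices `Aᵢ = A(eᵢ, ·, ·)` of a
cubic form. -/
def cubicQuartic (A : ι → ι → ι → ℝ) : ℝ :=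
  ∑ a, ∑ b, frobSq (Matrix.of (A a) * Matrix.of (A b) - Matrix.of (A b) * Matrix.of (A a))
    + ∑ a, ∑ b, (Matrix.of (A a) * Matrix.of (A b)).trace ^ 2

lemma cubicQuartic_le [DecidableEq ι] {A : ι → ι → ι → ℝ} (h : ∀ a b c, A a b c = A a c b) :
    cubicQuartic A ≤ 3 / 2 * (∑ a, ∑ b, ∑ c, A a b c ^ 2) ^ 2 :=
  sum_commutator_le (B := fun a => Matrix.of (A a)) fun a => by
    ext b c
    exact h a c b

/-- The diagonal of the Gram matrix gives `∑ (tr Aₐ A_b)² ≥ u² / n`. The commutators `Q` are tested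
against `G`, the constant-curvature tensor: trace-freeness gives `⟨Q, G⟩ = -2u`, and `‖G‖² = 2n(n -
1)`, so `∑ ‖[Aₐ, A_b]‖² ≥ 2u² / (n(n - 1))`. The two coefficients add to `(n + 1) / (n(n - 1))`. -/
lemma le_cubicQuartic [DecidableEq ι] {A : ι → ι → ι → ℝ} (h₁ : ∀ a b c, A a b c = A b a c)
    (h₂ : ∀ a b c, A a b c = A a c b) (htr : ∀ a, ∑ b, A a b b = 0) {n : ℝ}
    (hn : n = Fintype.card ι) (hn1 : 1 < n) :
    (n + 1) / (n * (n - 1)) * (∑ a, ∑ b, ∑ c, A a b c ^ 2) ^ 2 ≤ cubicQuartic A := by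
  set u := ∑ a, ∑ b, ∑ c, A a b c ^ 2
  set B : ι → Matrix ι ι ℝ := fun a => Matrix.of (A a)
  have hBs (a) : (B a).IsSymm := by
    ext b c
    exact h₂ a c b
  have hBu : ∑ a, (B a * B a).trace = u :=
    Finset.sum_congr rfl fun a _ => trace_self_mul (hBs a)
  have hric : u ^ 2 ≤ n * ∑ a, ∑ b, (B a * B b).trace ^ 2 := by
    have h1 : (∑ a, (B a * B a).trace) ^ 2 ≤ n * ∑ a, (B a * B a).trace ^ 2 := by
      rw [hn, ← Finset.card_univ]; exact sq_sum_le_card_mul_sum_sq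
    rw [hBu] at h1
    refine h1.trans (mul_le_mul_of_nonneg_left ?_ (by linarith))
    exact Finset.sum_le_sum fun a _ => Finset.single_le_sum
      (f := fun b => (B a * B b).trace ^ 2) (fun _ _ => sq_nonneg _) (Finset.mem_univ a)
  set Q : ι × ι × ι × ι → ℝ := fun p => (B p.1 * B p.2.1 - B p.2.1 * B p.1) p.2.2.1 p.2.2.2
  set δ : ι → ι → ℝ := fun a b => if a = b then 1 else 0
  set G : ι × ι × ι × ι → ℝ := fun p =>
    δ p.1 p.2.2.1 * δ p.2.1 p.2.2.2 - δ p.1 p.2.2.2 * δ p.2.1 p.2.2.1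
  have hQQ : ∑ p, Q p ^ 2 = ∑ a, ∑ b, frobSq (B a * B b - B b * B a) := by
    simp only [Fintype.sum_prod_type]; rfl
  have hGG : ∑ p, G p ^ 2 = 2 * (n * (n - 1)) := by
    -- The cross term of the square survives only when all four indices coincide, whence the count
    -- `n² + n² - 2n`.
    have hp (p : ι × ι × ι × ι) : G p ^ 2
        = δ p.1 p.2.2.1 * δ p.2.1 p.2.2.2 + δ p.1 p.2.2.2 * δ p.2.1 p.2.2.1
          - 2 * (δ p.1 p.2.1 * δ p.1 p.2.2.1 * δ p.1 p.2.2.2) := by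
      obtain ⟨a, b, c, d⟩ := p
      simp only [G, δ]
      by_cases h1 : a = c <;> by_cases h2 : b = d <;> by_cases h3 : a = d <;>
        by_cases h4 : b = c <;> by_cases h5 : a = b <;> simp_all <;> norm_num
    simp only [hp, Fintype.sum_prod_type, Finset.sum_add_distrib, Finset.sum_sub_distrib,
      ← Finset.mul_sum]
    simp [δ, ← hn]
    ring
  have hQG : ∑ p, Q p * G p = - 2 * u := by
    have e1 : ∑ p, Q p * G p
        = ∑ a, ∑ b, ((B a * B b - B b * B a) a b - (B a * B b - B b * B a) b a) := by
      simp only [Fintype.sum_prod_type, G, mul_sub, Finset.sum_sub_distrib]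
      congr 1
      · refine Finset.sum_congr rfl fun a _ => Finset.sum_congr rfl fun b _ => ?_
        simp [δ, Q]
      · refine Finset.sum_congr rfl fun a _ => Finset.sum_congr rfl fun b _ => ?_
        simp [δ, Q]
    have e2 (a b) : (B a * B b - B b * B a) a b - (B a * B b - B b * B a) b a
        = 2 * (∑ c, A c a a * A c b b - ∑ c, A a b c ^ 2) := by
      simp only [Matrix.sub_apply, Matrix.mul_apply, B, Matrix.of_apply, ← Finset.sum_sub_distrib,
        Finset.mul_sum]
      refine Finset.sum_congr rfl fun c _ => ?_
      rw [show A a a c = A c a a by rw [h₂ a a c, h₁ a c a], show A b c b = A c b b from h₁ b c b,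
        show A a c a = A c a a from h₁ a c a, show A b b c = A c b b by rw [h₂ b b c, h₁ b c b],
        show A b c a = A a b c by rw [h₂ b c a, h₁ b a c], show A b a c = A a b c from h₁ b a c,
        show A a c b = A a b c from h₂ a c b]
      ring
    have e3 : ∑ a, ∑ b, ∑ c, A c a a * A c b b = 0 := by
      calc _ = ∑ a, ∑ c, A c a a * ∑ b, A c b b := by
            refine Finset.sum_congr rfl fun a _ => ?_
            rw [Finset.sum_comm]
            exact Finset.sum_congr rfl fun c _ => (Finset.mul_sum _ _ _).symm
        _ = 0 := by simp [htr]
    rw [e1]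
    simp only [e2, ← Finset.mul_sum, Finset.sum_sub_distrib, e3]
    ring
  have hcs : (∑ p, Q p * G p) ^ 2 ≤ (∑ p, Q p ^ 2) * ∑ p, G p ^ 2 :=
    Finset.sum_mul_sq_le_sq_mul_sq _ _ _
  rw [hQG, hGG, hQQ] at hcs
  change _ ≤ ∑ a, ∑ b, frobSq (B a * B b - B b * B a) + ∑ a, ∑ b, (B a * B b).trace ^ 2
  set x := ∑ a, ∑ b, frobSq (B a * B b - B b * B a)
  set y := ∑ a, ∑ b, (B a * B b).trace ^ 2
  have hpos : 0 < n * (n - 1) := by nlinarith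
  rw [div_mul_eq_mul_div, div_le_iff₀ hpos]
  nlinarith [mul_le_mul_of_nonneg_right hric (by linarith : 0 ≤ n - 1)]

end MatrixInequalities

end StatGeom

namespace StatGeom

/-! ### Cubic arrays over a commutative ring and the action of matrices on them. -/

section FrameCalculus

open Matrix

variable {ι R : Type*} [Fintype ι] [CommRing R]

/-- The action of a matrix on the first index of a cubic array. -/
def slotOne (N : Matrix ι ι R) (T : ι → Matrix ι ι R) : ι → Matrix ι ι R :=
  fun j k l => ∑ m, N j m * T m k l

/-- The action of a matrix on the second index of a cubic array. -/
def slotTwo (N : Matrix ι ι R) (T : ι → Matrix ι ι R) : ι → Matrix ι ι R :=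
  fun j k l => ∑ m, N k m * T j m l

/-- The action of a matrix on the third index of a cubic array. -/
def slotThree (N : Matrix ι ι R) (T : ι → Matrix ι ι R) : ι → Matrix ι ι R :=
  fun j k l => ∑ m, N l m * T j k m

/-- The derivation action of a matrix on cubic arrays. -/
def cubicAct (N : Matrix ι ι R) (T : ι → Matrix ι ι R) : ι → Matrix ι ι R :=
  slotOne N T + slotTwo N T + slotThree N T

lemma cubicAct_apply (N : Matrix ι ι R) (T : ι → Matrix ι ι R) (j k l : ι) :
    cubicAct N T j k l
      = ∑ m, N j m * T m k l + ∑ m, N k m * T j m l + ∑ m, N l m * T j k m := rfl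

lemma cubicAct_sub_left (N N' : Matrix ι ι R) (T : ι → Matrix ι ι R) :
    cubicAct (N - N') T = cubicAct N T - cubicAct N' T := by
  ext j k l
  simp only [Pi.sub_apply, Matrix.sub_apply, cubicAct_apply, sub_mul, Finset.sum_sub_distrib]
  ring

lemma cubicAct_add_left (N N' : Matrix ι ι R) (T : ι → Matrix ι ι R) :
    cubicAct (N + N') T = cubicAct N T + cubicAct N' T := by
  ext j k l
  simp only [Pi.add_apply, Matrix.add_apply, cubicAct_apply, add_mul, Finset.sum_add_distrib]
  ring

lemma cubicAct_smul_left (r : R) (N : Matrix ι ι R) (T : ι → Matrix ι ι R) :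
    cubicAct (r • N) T = r • cubicAct N T := by
  ext j k l
  simp only [Pi.smul_apply, Matrix.smul_apply, cubicAct_apply, smul_eq_mul, mul_assoc,
    Finset.mul_sum, mul_add]

lemma cubicAct_sum_left {κ : Type*} (s : Finset κ) (N : κ → Matrix ι ι R)
    (T : ι → Matrix ι ι R) : cubicAct (∑ a ∈ s, N a) T = ∑ a ∈ s, cubicAct (N a) T := by
  classical
  induction s using Finset.induction_on with
  | empty => ext j k l; simp [cubicAct_apply]
  | insert a s ha ih =>
    rw [Finset.sum_insert ha, Finset.sum_insert ha, ← ih]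
    ext j k l
    simp only [Pi.add_apply, Matrix.add_apply, cubicAct_apply, add_mul, Finset.sum_add_distrib]
    ring

lemma cubicAct_sub (N : Matrix ι ι R) (T T' : ι → Matrix ι ι R) :
    cubicAct N (T - T') = cubicAct N T - cubicAct N T' := by
  ext j k l
  simp only [Pi.sub_apply, Matrix.sub_apply, cubicAct_apply, mul_sub, Finset.sum_sub_distrib]
  ring

lemma slot_comm_aux (f g : ι → R) (h : ι → ι → R) :
    ∑ m, f m * ∑ p, g p * h m p = ∑ p, g p * ∑ m, f m * h m p := by
  simp only [Finset.mul_sum]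
  rw [Finset.sum_comm]
  exact Finset.sum_congr rfl fun _ _ => Finset.sum_congr rfl fun _ _ => by ring

lemma slot_mul_aux (f : ι → R) (N : Matrix ι ι R) (h : ι → R) :
    ∑ m, f m * ∑ p, N m p * h p = ∑ p, (∑ m, f m * N m p) * h p := by
  simp only [Finset.mul_sum, Finset.sum_mul]
  rw [Finset.sum_comm]
  exact Finset.sum_congr rfl fun _ _ => Finset.sum_congr rfl fun _ _ => by ring

/-- The action is a Lie algebra representation: actions on different slots commute, and on one slot
they compose by matrix multiplication. -/
lemma cubicAct_commutator (N N' : Matrix ι ι R) (T : ι → Matrix ι ι R) :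
    cubicAct N (cubicAct N' T) - cubicAct N' (cubicAct N T) = cubicAct (N * N' - N' * N) T := by
  have add₁ (N : Matrix ι ι R) (T T') : slotOne N (T + T') = slotOne N T + slotOne N T' := by
    ext j k l
    simp only [slotOne, Pi.add_apply, Matrix.add_apply, mul_add, Finset.sum_add_distrib]
  have add₂ (N : Matrix ι ι R) (T T') : slotTwo N (T + T') = slotTwo N T + slotTwo N T' := by
    ext j k l
    simp only [slotTwo, Pi.add_apply, Matrix.add_apply, mul_add, Finset.sum_add_distrib]
  have add₃ (N : Matrix ι ι R) (T T') : slotThree N (T + T') = slotThree N T + slotThree N T' := by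
    ext j k l
    simp only [slotThree, Pi.add_apply, Matrix.add_apply, mul_add, Finset.sum_add_distrib]
  have c₁₂ (N N' : Matrix ι ι R) : slotOne N (slotTwo N' T) = slotTwo N' (slotOne N T) := by
    ext j k l; exact slot_comm_aux _ _ _
  have c₁₃ (N N' : Matrix ι ι R) : slotOne N (slotThree N' T) = slotThree N' (slotOne N T) := by
    ext j k l; exact slot_comm_aux _ _ _
  have c₂₃ (N N' : Matrix ι ι R) : slotTwo N (slotThree N' T) = slotThree N' (slotTwo N T) := by
    ext j k l; exact slot_comm_aux _ _ _
  have m₁ (N N' : Matrix ι ι R) : slotOne N (slotOne N' T) = slotOne (N * N') T := by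
    ext j k l; exact slot_mul_aux _ _ _
  have m₂ (N N' : Matrix ι ι R) : slotTwo N (slotTwo N' T) = slotTwo (N * N') T := by
    ext j k l; exact slot_mul_aux _ _ _
  have m₃ (N N' : Matrix ι ι R) : slotThree N (slotThree N' T) = slotThree (N * N') T := by
    ext j k l; exact slot_mul_aux _ _ _
  rw [cubicAct_sub_left]
  simp only [cubicAct, add₁, add₂, add₃, c₁₂, c₁₃, c₂₃, m₁, m₂, m₃]
  abel

/-- The full contraction of two cubic arrays. -/
def cubicInner (T T' : ι → Matrix ι ι R) : R := ∑ j, ∑ k, ∑ l, T j k l * T' j k l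

lemma cubicInner_comm (T T' : ι → Matrix ι ι R) : cubicInner T T' = cubicInner T' T := by
  simp only [cubicInner, mul_comm]

lemma cubicInner_add_left (T T' S : ι → Matrix ι ι R) :
    cubicInner (T + T') S = cubicInner T S + cubicInner T' S := by
  simp only [cubicInner, Pi.add_apply, Matrix.add_apply, add_mul, Finset.sum_add_distrib]

lemma cubicInner_sub_right (S T T' : ι → Matrix ι ι R) :
    cubicInner S (T - T') = cubicInner S T - cubicInner S T' := by
  simp only [cubicInner, Pi.sub_apply, Matrix.sub_apply, mul_sub, Finset.sum_sub_distrib]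

lemma cubicInner_smul_right (r : R) (S T : ι → Matrix ι ι R) :
    cubicInner S (r • T) = r * cubicInner S T := by
  simp only [cubicInner, Pi.smul_apply, Matrix.smul_apply, smul_eq_mul, Finset.mul_sum]
  exact Finset.sum_congr rfl fun _ _ => Finset.sum_congr rfl fun _ _ =>
    Finset.sum_congr rfl fun _ _ => by ring

lemma cubicInner_sum_right {κ : Type*} (s : Finset κ) (S : ι → Matrix ι ι R)
    (T : κ → ι → Matrix ι ι R) : cubicInner S (∑ a ∈ s, T a) = ∑ a ∈ s, cubicInner S (T a) := by
  classical
  induction s using Finset.induction_on with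
  | empty => simp [cubicInner]
  | insert a s ha ih =>
    rw [Finset.sum_insert ha, Finset.sum_insert ha, ← ih, cubicInner_comm, cubicInner_add_left,
      cubicInner_comm, cubicInner_comm _ S]

/-- A skew matrix acts as an infinitesimal rotation, so it preserves the contraction. This is the
algebraic form of metric compatibility. -/
lemma cubicInner_cubicAct {N : Matrix ι ι R} (hN : ∀ i j, N i j = - N j i)
    (T T' : ι → Matrix ι ι R) :
    cubicInner (cubicAct N T) T' + cubicInner T (cubicAct N T') = 0 := by
  have aux (f g : ι → R) : ∑ j, (∑ m, N j m * f m) * g j + ∑ j, f j * ∑ m, N j m * g m = 0 := by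
    simp only [Finset.sum_mul, Finset.mul_sum]
    rw [Finset.sum_comm (f := fun j m => f j * (N j m * g m)), ← Finset.sum_add_distrib]
    refine Finset.sum_eq_zero fun j _ => ?_
    rw [← Finset.sum_add_distrib]
    refine Finset.sum_eq_zero fun m _ => ?_
    rw [hN m j]; ring
  have h₃ : ∑ j, ∑ k, ((∑ l, (∑ m, N l m * T j k m) * T' j k l)
      + ∑ l, T j k l * ∑ m, N l m * T' j k m) = 0 :=
    Finset.sum_eq_zero fun j _ => Finset.sum_eq_zero fun k _ => aux _ _
  have h₂ : ∑ j, ∑ l, ((∑ k, (∑ m, N k m * T j m l) * T' j k l)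
      + ∑ k, T j k l * ∑ m, N k m * T' j m l) = 0 :=
    Finset.sum_eq_zero fun j _ => Finset.sum_eq_zero fun l _ => 
      aux (fun m => T j m l) (fun m => T' j m l)
  have h₁ : ∑ k, ∑ l, ((∑ j, (∑ m, N j m * T m k l) * T' j k l)
      + ∑ j, T j k l * ∑ m, N j m * T' m k l) = 0 :=
    Finset.sum_eq_zero fun k _ => Finset.sum_eq_zero fun l _ =>
      aux (fun m => T m k l) (fun m => T' m k l)
  simp only [Finset.sum_add_distrib] at h₁ h₂ h₃
  have c₂ (f : ι → ι → ι → R) : ∑ j, ∑ l, ∑ k, f j k l = ∑ j, ∑ k, ∑ l, f j k l :=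
    Finset.sum_congr rfl fun _ _ => Finset.sum_comm
  have c₁ (f : ι → ι → ι → R) : ∑ k, ∑ l, ∑ j, f j k l = ∑ j, ∑ k, ∑ l, f j k l := by
    rw [Finset.sum_comm (f := fun j k => ∑ l, f j k l)]
    exact Finset.sum_congr rfl fun _ _ => Finset.sum_comm
  rw [c₂ (fun j k l => (∑ m, N k m * T j m l) * T' j k l),
    c₂ (fun j k l => T j k l * ∑ m, N k m * T' j m l)] at h₂
  rw [c₁ (fun j k l => (∑ m, N j m * T m k l) * T' j k l),
    c₁ (fun j k l => T j k l * ∑ m, N j m * T' m k l)] at h₁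
  simp only [cubicInner, cubicAct_apply, add_mul, mul_add, Finset.sum_add_distrib]
  linear_combination h₁ + h₂ + h₃

/-- Skew connection terms cancel when two indices are contracted; hence traces commute with
covariant differentiation. -/
lemma sum_skew_trace {N : ι → ι → R} (hN : ∀ i j, N i j = - N j i) (X : ι → ι → R) :
    ∑ b, ∑ m, N b m * X m b + ∑ b, ∑ m, N b m * X b m = 0 := by
  rw [Finset.sum_comm, ← Finset.sum_add_distrib]
  refine Finset.sum_eq_zero fun b _ => ?_
  rw [← Finset.sum_add_distrib]
  exact Finset.sum_eq_zero fun m _ => by rw [hN m b]; ring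

/-! ### Covariant derivatives, curvature and the Bochner–Simons formula in a frame. -/

variable [Algebra ℝ R] (D : ι → Derivation ℝ R R) (W : ι → Matrix ι ι R)

/-- The entrywise derivative of a cubic array. -/
def derivArray (d : Derivation ℝ R R) (T : ι → Matrix ι ι R) : ι → Matrix ι ι R :=
  fun j => (T j).map d

/-- The covariant derivative in the direction `a` of a cubic array for the connection matrices
`W`. -/
def covD (a : ι) (T : ι → Matrix ι ι R) : ι → Matrix ι ι R :=
  derivArray (D a) T - cubicAct (W a) T

lemma covD_apply (a : ι) (T : ι → Matrix ι ι R) (j k l : ι) :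
    covD D W a T j k l = D a (T j k l)
      - (∑ m, W a j m * T m k l + ∑ m, W a k m * T j m l + ∑ m, W a l m * T j k m) := rfl

/-- The curvature matrices of the connection matrices `W`, for a frame with structure functions
`c`. -/
def frameCurvature (c : ι → ι → ι → R) (a b : ι) : Matrix ι ι R :=
  (W b).map (D a) - (W a).map (D b) - (W a * W b - W b * W a) - ∑ m, c a b m • W m

lemma derivArray_cubicAct (d : Derivation ℝ R R) (N : Matrix ι ι R) (T : ι → Matrix ι ι R) :
    derivArray d (cubicAct N T) = cubicAct (N.map d) T + cubicAct N (derivArray d T) := by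
  ext j k l
  simp only [derivArray, Matrix.map_apply, Pi.add_apply, Matrix.add_apply, cubicAct_apply, map_add,
    map_sum, Derivation.leibniz, smul_eq_mul, Finset.sum_add_distrib]
  simp only [mul_comm (d _)]
  ring_nf

/-- The Ricci identity. -/
lemma covD_covD_sub {c : ι → ι → ι → R}
    (hc : ∀ a b f, D a (D b f) - D b (D a f) = ∑ m, c a b m * D m f)
    (T : ι → Matrix ι ι R) (a b : ι) :
    covD D W a (covD D W b T) - covD D W b (covD D W a T) - ∑ m, c a b m • covD D W m T
      = - cubicAct (frameCurvature D W c a b) T := by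
  have hsub (d : Derivation ℝ R R) (T T' : ι → Matrix ι ι R) :
      derivArray d (T - T') = derivArray d T - derivArray d T' := by
    ext j k l; simp [derivArray]
  have hD : derivArray (D a) (derivArray (D b) T) - derivArray (D b) (derivArray (D a) T)
      = ∑ m, c a b m • derivArray (D m) T := by
    ext j k l
    simp only [derivArray, Pi.sub_apply, Matrix.sub_apply, Matrix.map_apply, Finset.sum_apply,
      Matrix.sum_apply, Pi.smul_apply, Matrix.smul_apply, smul_eq_mul]
    exact hc a b _
  -- The mixed terms cancel by Leibniz and the pure derivatives give the structure functions, so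
  -- only the commutator of the two actions and the derivatives of `W` remain.
  have hcomm := cubicAct_commutator (W a) (W b) T
  simp only [covD, frameCurvature, cubicAct_sub_left, cubicAct_sum_left, cubicAct_smul_left,
    cubicAct_sub, hsub, derivArray_cubicAct, smul_sub, Finset.sum_sub_distrib]
  rw [← hD, ← cubicAct_sub_left (W a * W b), ← hcomm]
  abel

lemma deriv_cubicInner (hW : ∀ a i j, W a i j = - W a j i) (a : ι) (T T' : ι → Matrix ι ι R) :
    D a (cubicInner T T') = cubicInner (covD D W a T) T' + cubicInner T (covD D W a T') := by
  have h := cubicInner_cubicAct (hW a) T T'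
  have h1 : D a (cubicInner T T')
      = cubicInner T (derivArray (D a) T') + cubicInner (derivArray (D a) T) T' := by
    simp only [cubicInner, map_sum, Derivation.leibniz, smul_eq_mul, Finset.sum_add_distrib,
      derivArray, Matrix.map_apply]
    congr 1
    simp only [mul_comm]
  rw [h1, covD, covD, cubicInner_sub_right, cubicInner_comm (_ - _), cubicInner_sub_right,
    cubicInner_comm T' (cubicAct _ _), cubicInner_comm T' (derivArray _ _)]
  linear_combination h

/-- The second covariant derivative `∇²_{a,b} T`, where `W a b m` are the frame coefficients of the
derivative of the `b`-th frame field in the direction `a`. -/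
def secondCovD (T : ι → Matrix ι ι R) (a b : ι) : ι → Matrix ι ι R :=
  covD D W a (covD D W b T) - ∑ m, W a b m • covD D W m T

lemma secondCovD_apply (T : ι → Matrix ι ι R) (a b j k l : ι) :
    secondCovD D W T a b j k l = D a (covD D W b T j k l)
      - (∑ m, W a b m * covD D W m T j k l + ∑ m, W a j m * covD D W b T m k l
        + ∑ m, W a k m * covD D W b T j m l + ∑ m, W a l m * covD D W b T j k m) := by
  simp only [secondCovD, Pi.sub_apply, Matrix.sub_apply, covD_apply _ _ a, Finset.sum_apply,
    Matrix.sum_apply, Pi.smul_apply, Matrix.smul_apply, smul_eq_mul]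
  ring

/-- Skewness of `W` allows the contraction to be differentiated covariantly twice; the terms `W a a
m` of the function Laplacian are exactly the correction contained in `secondCovD`. -/
lemma laplacian_cubicInner_self (hW : ∀ a i j, W a i j = - W a j i) (T : ι → Matrix ι ι R) :
    ∑ a, (D a (D a (cubicInner T T)) - ∑ m, W a a m * D m (cubicInner T T))
      = 2 * ∑ a, cubicInner (covD D W a T) (covD D W a T)
        + 2 * cubicInner T (∑ a, secondCovD D W T a a) := by
  have h1 (a) : D a (cubicInner T T) = 2 * cubicInner T (covD D W a T) := by
    rw [deriv_cubicInner D W hW, cubicInner_comm]; ring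
  have h2 (a) : D a (2 * cubicInner T (covD D W a T))
      = 2 * (cubicInner (covD D W a T) (covD D W a T)
        + cubicInner T (covD D W a (covD D W a T))) := by
    rw [← deriv_cubicInner D W hW, two_mul, two_mul, map_add]
  simp only [h1, h2, cubicInner_sum_right, secondCovD, cubicInner_sub_right, cubicInner_smul_right,
    Finset.mul_sum, ← Finset.sum_add_distrib]
  refine Finset.sum_congr rfl fun a _ => ?_
  rw [mul_sub, mul_add, Finset.mul_sum, add_sub_assoc]
  congr 2
  exact Finset.sum_congr rfl fun m _ => by ring

lemma covD_swap {T : ι → Matrix ι ι R} (h : ∀ a b c, T a b c = T b a c) (a j k l : ι) :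
    covD D W a T j k l = covD D W a T k j l := by
  have e₁ : ∑ m, W a j m * T m k l = ∑ m, W a j m * T k m l :=
    Finset.sum_congr rfl fun m _ => congrArg (W a j m * ·) (h m k l)
  have e₂ : ∑ m, W a k m * T j m l = ∑ m, W a k m * T m j l :=
    Finset.sum_congr rfl fun m _ => congrArg (W a k m * ·) (h j m l)
  have e₃ : ∑ m, W a l m * T j k m = ∑ m, W a l m * T k j m :=
    Finset.sum_congr rfl fun m _ => congrArg (W a l m * ·) (h j k m)
  rw [covD_apply, covD_apply, h j k l]
  linear_combination -e₁ - e₂ - e₃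

/-- The Simons-type formula: for a trace-free cubic form with totally symmetric covariant
derivative, the rough Laplacian is given by a contraction with the curvature. -/
lemma sum_secondCovD_eq (hW : ∀ a i j, W a i j = - W a j i)
    (hc : ∀ a b f, D a (D b f) - D b (D a f) = ∑ m, (W a b m - W b a m) * D m f)
    {A : ι → Matrix ι ι R} (hA : ∀ a b c, A a b c = A b a c)
    (hS : ∀ a b c d, covD D W a A b c d = covD D W b A a c d)
    (htr : ∀ c, ∑ a, A a a c = 0) (j k l : ι) :
    (∑ a, secondCovD D W A a a) j k l
      = - ∑ a, cubicAct (frameCurvature D W (fun a b m => W a b m - W b a m) a j) A a k l := by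
  have trS (a d) : ∑ b, covD D W a A b b d = 0 := by
    have e1 := sum_skew_trace (hW a) fun b m => A b m d
    have e2 : ∑ b, ∑ m, W a d m * A b b m = 0 := by
      rw [Finset.sum_comm]
      simp only [← Finset.mul_sum, htr, mul_zero, Finset.sum_const_zero]
    simp only [covD_apply, Finset.sum_sub_distrib, Finset.sum_add_distrib, ← map_sum, htr, map_zero]
    linear_combination -e1 - e2
  have trS' (c d) : ∑ b, covD D W b A b c d = 0 := by
    rw [← trS c d]
    exact Finset.sum_congr rfl fun b _ => by rw [covD_swap D W hA, hS b c]
  -- The Codazzi symmetry holds as an identity of functions, so it may be differentiated: it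
  -- exchanges the inner direction with the first index.
  have swap (a b j k l) : secondCovD D W A a b j k l = secondCovD D W A a j b k l := by
    have e₁ : ∑ m, W a b m * covD D W m A j k l = ∑ m, W a b m * covD D W j A m k l :=
      Finset.sum_congr rfl fun m _ => congrArg (W a b m * ·) (hS m j k l)
    have e₂ : ∑ m, W a j m * covD D W b A m k l = ∑ m, W a j m * covD D W m A b k l :=
      Finset.sum_congr rfl fun m _ => congrArg (W a j m * ·) (hS b m k l)
    have e₃ : ∑ m, W a k m * covD D W b A j m l = ∑ m, W a k m * covD D W j A b m l :=
      Finset.sum_congr rfl fun m _ => congrArg (W a k m * ·) (hS b j m l)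
    have e₄ : ∑ m, W a l m * covD D W b A j k m = ∑ m, W a l m * covD D W j A b k m :=
      Finset.sum_congr rfl fun m _ => congrArg (W a l m * ·) (hS b j k m)
    rw [secondCovD_apply, secondCovD_apply, hS b j k l]
    linear_combination -e₁ - e₂ - e₃ - e₄
  have ricci (a) : secondCovD D W A a j a k l = secondCovD D W A j a a k l
      - cubicAct (frameCurvature D W (fun a b m => W a b m - W b a m) a j) A a k l := by
    have h := congrFun (congrFun (congrFun (covD_covD_sub D W hc A a j) a) k) l
    simp only [sub_smul, Finset.sum_sub_distrib] at h
    simp only [secondCovD, Pi.sub_apply, Matrix.sub_apply, Pi.neg_apply, Matrix.neg_apply] at h ⊢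
    linear_combination h
  -- The contraction is the derivative in direction `j` of the divergence of `A`, which is zero by
  -- `trS'`.
  have tr : ∑ a, secondCovD D W A j a a k l = 0 := by
    have e1 := sum_skew_trace (hW j) fun b m => covD D W b A m k l
    have e2 : ∑ b, ∑ m, W j k m * covD D W b A b m l = 0 := by
      rw [Finset.sum_comm]
      simp only [← Finset.mul_sum, trS', mul_zero, Finset.sum_const_zero]
    have e3 : ∑ b, ∑ m, W j l m * covD D W b A b k m = 0 := by
      rw [Finset.sum_comm]
      simp only [← Finset.mul_sum, trS', mul_zero, Finset.sum_const_zero]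
    simp only [secondCovD_apply, Finset.sum_sub_distrib, Finset.sum_add_distrib, ← map_sum, trS',
      map_zero]
    linear_combination -e1 - e2 - e3
  simp only [Finset.sum_apply, Matrix.sum_apply]
  rw [Finset.sum_congr rfl fun a _ => (swap a a j k l).trans (ricci a), Finset.sum_sub_distrib, tr,
    zero_sub]

/-- Two is invertible because the ring is an ℝ-algebra. -/
lemma eq_zero_of_add_self_eq_zero {r : R} (h : r + r = 0) : r = 0 := by
  have h2 : (2 : ℝ) • r = 0 := by rw [two_smul, h]
  simpa using congrArg (fun s => (2⁻¹ : ℝ) • s) h2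

/-- If the curvature matrices of the connection matrices `W + A`, with `W` skew and `A` symmetric,
are skew, then `A` satisfies the Codazzi equation and the curvature of `W` is given by the Gauss
equation. -/
lemma codazzi_gauss (hW : ∀ a i j, W a i j = - W a j i) {A : ι → Matrix ι ι R}
    (hA₂ : ∀ a b c, A a b c = A a c b) {c : ι → ι → ι → R}
    (hcW : ∀ a b m, c a b m = W a b m - W b a m)
    (hQ : ∀ a b i j, frameCurvature D (W + A) c a b i j = - frameCurvature D (W + A) c a b j i) :
    (∀ a b i j, covD D W a A b i j = covD D W b A a i j) ∧
    ∀ a b, frameCurvature D W c a b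
      = frameCurvature D (W + A) c a b + (A a * A b - A b * A a) := by
  have hWt (a) : (W a)ᵀ = - W a := by
    ext i j; exact hW a j i
  have hAt (a) : (A a)ᵀ = A a := by
    ext i j; exact hA₂ a j i
  have hmap (a b) : (W b + A b).map (D a) = (W b).map (D a) + (A b).map (D a) := by
    ext i j; simp
  -- `X` collects the terms linear in `A`. It is symmetric, while the curvature of `W` and the
  -- commutator of two `A` are skew; a skew total curvature therefore forces `X = 0`, which is the
  -- Codazzi equation.
  set X : ι → ι → Matrix ι ι R := fun a b => (A b).map (D a) - (A a).map (D b)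
    - (W a * A b + A a * W b - W b * A a - A b * W a) - ∑ m, c a b m • A m with hX
  have hdec (a b) : frameCurvature D (W + A) c a b
      = frameCurvature D W c a b - (A a * A b - A b * A a) + X a b := by
    simp only [frameCurvature, hX, hmap, Pi.add_apply, smul_add, Finset.sum_add_distrib,
      Matrix.add_mul, Matrix.mul_add]
    abel
  have hFt (a b) : (frameCurvature D W c a b)ᵀ = - frameCurvature D W c a b := by
    have hm (a b) : ((W b).map (D a))ᵀ = - (W b).map (D a) := by
      ext i j
      simp only [Matrix.transpose_apply, Matrix.map_apply, Matrix.neg_apply]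
      rw [hW b j i, map_neg]
    simp only [frameCurvature, Matrix.transpose_sub, hm, Matrix.transpose_mul, hWt,
      Matrix.transpose_sum, Matrix.transpose_smul, smul_neg, Finset.sum_neg_distrib,
      Matrix.neg_mul, Matrix.mul_neg, neg_neg]
    abel
  have hXt (a b) : (X a b)ᵀ = X a b := by
    have hm (a b) : ((A b).map (D a))ᵀ = (A b).map (D a) := by
      ext i j
      simp only [Matrix.transpose_apply, Matrix.map_apply, hA₂ b j i]
    simp only [hX, Matrix.transpose_sub, Matrix.transpose_add, hm, Matrix.transpose_mul, hWt, hAt,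
      Matrix.transpose_sum, Matrix.transpose_smul, Matrix.neg_mul, Matrix.mul_neg]
    abel
  have hX0 (a b) : X a b = 0 := by
    have hQt : (frameCurvature D (W + A) c a b)ᵀ = - frameCurvature D (W + A) c a b := by
      ext i j; exact hQ a b j i
    rw [hdec, Matrix.transpose_add, Matrix.transpose_sub, hFt, hXt, Matrix.transpose_sub,
      Matrix.transpose_mul, Matrix.transpose_mul, hAt, hAt] at hQt
    ext i j
    refine eq_zero_of_add_self_eq_zero ?_
    have := congrFun (congrFun hQt i) j
    simp only [Matrix.add_apply, Matrix.sub_apply, Matrix.neg_apply] at this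
    linear_combination this
  refine ⟨fun a b i j => ?_, fun a b => ?_⟩
  · have h := congrFun (congrFun (hX0 a b) i) j
    simp only [hX, Matrix.sub_apply, Matrix.add_apply, Matrix.map_apply, Matrix.mul_apply,
      Matrix.sum_apply, Matrix.smul_apply, smul_eq_mul, hcW, sub_mul, Finset.sum_sub_distrib,
      Matrix.zero_apply] at h
    rw [covD_apply, covD_apply]
    have e1 : ∑ m, A a i m * W b m j = - ∑ m, W b j m * A a i m := by
      rw [← Finset.sum_neg_distrib]
      exact Finset.sum_congr rfl fun m _ => by rw [hW b j m]; ring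
    have e2 : ∑ m, A b i m * W a m j = - ∑ m, W a j m * A b i m := by
      rw [← Finset.sum_neg_distrib]
      exact Finset.sum_congr rfl fun m _ => by rw [hW a j m]; ring
    linear_combination h + e1 - e2
  · rw [hdec, hX0]; abel

/-- The Bochner–Simons formula in a frame. -/
theorem bochner_simons (hW : ∀ a i j, W a i j = - W a j i)
    (hc : ∀ a b f, D a (D b f) - D b (D a f) = ∑ m, (W a b m - W b a m) * D m f)
    {A : ι → Matrix ι ι R} (hA₁ : ∀ a b c, A a b c = A b a c) (hA₂ : ∀ a b c, A a b c = A a c b)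
    (htr : ∀ c, ∑ a, A a a c = 0)
    (hQ : ∀ a b i j, frameCurvature D (W + A) (fun a b m => W a b m - W b a m) a b i j
      = - frameCurvature D (W + A) (fun a b m => W a b m - W b a m) a b j i) :
    ∑ a, (D a (D a (cubicInner A A)) - ∑ m, W a a m * D m (cubicInner A A))
      = 2 * ∑ a, cubicInner (covD D W a A) (covD D W a A)
        - 2 * ∑ j, ∑ k, ∑ l, A j k l * ∑ a, cubicAct
          (frameCurvature D (W + A) (fun a b m => W a b m - W b a m) a j
            + (A a * A j - A j * A a)) A a k l := by
  obtain ⟨hS, hF⟩ := codazzi_gauss D W hW hA₂ (fun _ _ _ => rfl) hQ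
  rw [laplacian_cubicInner_self D W hW, sub_eq_add_neg, ← mul_neg, cubicInner]
  congr 2
  simp only [← Finset.sum_neg_distrib, ← hF]
  refine Finset.sum_congr rfl fun j _ => Finset.sum_congr rfl fun k _ =>
    Finset.sum_congr rfl fun l _ => ?_
  rw [sum_secondCovD_eq D W hW hc hA₁ hS htr, mul_neg]

end FrameCalculus

/-! ### The curvature contraction for the Gauss equation of constant curvature. -/

section SpaceForm

open Matrix

variable {ι : Type*} [Fintype ι] [DecidableEq ι]

/-- The curvature term of the Bochner–Simons formula for constant curvature. -/
lemma curvature_contraction {A : ι → Matrix ι ι ℝ}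
    (hA₁ : ∀ a b c, A a b c = A b a c) (hA₂ : ∀ a b c, A a b c = A a c b)
    (htr : ∀ c, ∑ a, A a a c = 0) {Q : ι → ι → Matrix ι ι ℝ} {h : ℝ}
    (hQ : ∀ a b i j, Q a b i j
      = h * ((if b = i then 1 else 0) * (if a = j then 1 else 0)
        - (if a = i then 1 else 0) * (if b = j then 1 else 0))) :
    - ∑ j, ∑ k, ∑ l, A j k l * ∑ a, cubicAct (Q a j + (A a * A j - A j * A a)) A a k l
      = (Fintype.card ι + 1) * h * cubicInner A A + cubicQuartic A := by
  have hAt (a) : (A a)ᵀ = A a := by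
    ext i j; exact hA₂ a j i
  set C : ι → ι → Matrix ι ι ℝ := fun a j => A a * A j - A j * A a with hC
  have hCt (a j) : (C a j)ᵀ = - C a j := by
    simp only [hC, Matrix.transpose_sub, Matrix.transpose_mul, hAt]; abel
  have htr' (l) : ∑ a, A a l a = 0 := by
    rw [← htr l]; exact Finset.sum_congr rfl fun a _ => hA₂ a l a
  -- The first slot contributes `n - 1` copies of `-h A j k l` and the other two slots one each; the
  -- remaining Kronecker terms are traces of `A`.
  have q (j k l) : ∑ a, cubicAct (Q a j) A a k l
      = - ((Fintype.card ι + 1) * h * A j k l) := by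
    simp only [cubicAct_apply, hQ, mul_sub, sub_mul, Finset.sum_add_distrib,
      Finset.sum_sub_distrib]
    simp [← Finset.mul_sum, mul_assoc, htr, htr', hA₁ k j l, hA₁ l, hA₂ k l j]
    ring
  -- The commutator on the first slot is contracted as a Ricci tensor; by trace-freeness it equals
  -- `-tr (Aⱼ Aₘ)`.
  have t₁ : ∑ j, ∑ k, ∑ l, A j k l * ∑ a, ∑ m, C a j a m * A m k l
      = - ∑ j, ∑ m, (A j * A m).trace ^ 2 := by
    have e1 (j m) : ∑ a, C a j a m = - (A j * A m).trace := by
      have z : ∑ a, ∑ p, A a a p * A j p m = 0 := by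
        rw [Finset.sum_comm]
        simp only [← Finset.sum_mul, htr, zero_mul, Finset.sum_const_zero]
      simp only [hC, Matrix.sub_apply, Matrix.mul_apply, Finset.sum_sub_distrib, z, zero_sub,
        Matrix.trace, Matrix.diag]
      congr 1
      refine Finset.sum_congr rfl fun a _ => Finset.sum_congr rfl fun p _ => ?_
      rw [hA₂ a p m, hA₁ a m p, hA₂ m a p]
    have e2 (j m) : (A j * A m).trace = ∑ k, ∑ l, A j k l * A m k l := by
      simp only [Matrix.trace, Matrix.diag, Matrix.mul_apply]
      exact Finset.sum_congr rfl fun a _ => Finset.sum_congr rfl fun p _ => by rw [hA₂ m p a]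
    rw [← Finset.sum_neg_distrib]
    refine Finset.sum_congr rfl fun j _ => ?_
    rw [← Finset.sum_neg_distrib]
    calc _ = ∑ k, ∑ l, ∑ m, - (A j * A m).trace * (A j k l * A m k l) := by
          refine Finset.sum_congr rfl fun k _ => Finset.sum_congr rfl fun l _ => ?_
          rw [Finset.sum_comm, Finset.mul_sum]
          refine Finset.sum_congr rfl fun m _ => ?_
          rw [← Finset.sum_mul, e1]; ring
      _ = ∑ m, ∑ k, ∑ l, - (A j * A m).trace * (A j k l * A m k l) := by
          rw [Finset.sum_comm (f := fun m k => ∑ l, - (A j * A m).trace * (A j k l * A m k l))]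
          exact Finset.sum_congr rfl fun k _ => Finset.sum_comm
      _ = _ := by
          refine Finset.sum_congr rfl fun m _ => ?_
          simp only [← Finset.mul_sum, ← e2]; ring
  -- Since `C` is skew, `tr (C Aⱼ Aₐ) = -tr (C Aₐ Aⱼ)`, so `tr (C²) = 2 tr (C Aₐ Aⱼ)`. The second
  -- and third slots give this trace once each, hence `-∑ ‖C‖²` together.
  have hfrob (a j) : 2 * (C a j * (A a * A j)).trace = - frobSq (C a j) := by
    have e1 : (C a j * (A j * A a)).trace = - (C a j * (A a * A j)).trace := by
      rw [← Matrix.trace_transpose, Matrix.transpose_mul, hCt, Matrix.transpose_mul, hAt, hAt,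
        Matrix.mul_neg, Matrix.trace_neg, Matrix.trace_mul_comm]
    rw [frobSq_eq_trace, hCt, Matrix.neg_mul, Matrix.trace_neg]
    conv_rhs => rw [show C a j * C a j = C a j * (A a * A j) - C a j * (A j * A a) by
      rw [← Matrix.mul_sub]]
    rw [Matrix.trace_sub, e1]; ring
  have t₂ : ∑ j, ∑ k, ∑ l, A j k l * ∑ a, ∑ m, C a j k m * A a m l
      = ∑ a, ∑ j, (C a j * (A a * A j)).trace := by
    rw [Finset.sum_comm (f := fun a j => (C a j * (A a * A j)).trace)]
    refine Finset.sum_congr rfl fun j _ => ?_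
    have e (f : ι → ι → ι → ι → ℝ) :
        ∑ k, ∑ l, ∑ a, ∑ m, f k l a m = ∑ a, ∑ k, ∑ m, ∑ l, f k l a m := by
      rw [Finset.sum_comm (f := fun a k => ∑ m, ∑ l, f k l a m)]
      refine Finset.sum_congr rfl fun k _ => ?_
      rw [Finset.sum_comm]
      exact Finset.sum_congr rfl fun a _ => Finset.sum_comm
    simp only [Finset.mul_sum, Matrix.trace, Matrix.diag, Matrix.mul_apply]
    rw [e]
    refine Finset.sum_congr rfl fun a _ => Finset.sum_congr rfl fun k _ =>
      Finset.sum_congr rfl fun m _ => Finset.sum_congr rfl fun l _ => ?_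
    rw [hA₂ j k l]; ring
  have t₃ : ∑ j, ∑ k, ∑ l, A j k l * ∑ a, ∑ m, C a j l m * A a k m
      = ∑ a, ∑ j, (C a j * (A a * A j)).trace := by
    rw [← t₂]
    refine Finset.sum_congr rfl fun j _ => ?_
    rw [Finset.sum_comm]
    refine Finset.sum_congr rfl fun k _ => Finset.sum_congr rfl fun l _ => ?_
    rw [hA₂ j l k]
    congr 1
    exact Finset.sum_congr rfl fun a _ => Finset.sum_congr rfl fun m _ => by rw [hA₂ a l m]
  have hsum : 2 * ∑ a, ∑ j, (C a j * (A a * A j)).trace = - ∑ a, ∑ j, frobSq (C a j) := by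
    simp only [Finset.mul_sum, hfrob, Finset.sum_neg_distrib]
  have hquart : cubicQuartic A = ∑ a, ∑ j, frobSq (C a j) + ∑ j, ∑ m, (A j * A m).trace ^ 2 := rfl
  have hterm (j k l) : A j k l * ∑ a, cubicAct (Q a j + C a j) A a k l
      = - ((Fintype.card ι + 1) * h) * (A j k l * A j k l)
        + (A j k l * ∑ a, ∑ m, C a j a m * A m k l + A j k l * ∑ a, ∑ m, C a j k m * A a m l
        + A j k l * ∑ a, ∑ m, C a j l m * A a k m) := by
    have e : ∑ a, cubicAct (Q a j + C a j) A a k l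
        = ∑ a, cubicAct (Q a j) A a k l + (∑ a, ∑ m, C a j a m * A m k l
          + ∑ a, ∑ m, C a j k m * A a m l + ∑ a, ∑ m, C a j l m * A a k m) := by
      simp only [← Finset.sum_add_distrib]
      refine Finset.sum_congr rfl fun a _ => ?_
      rw [cubicAct_add_left, Finset.sum_add_distrib, Finset.sum_add_distrib]
      rfl
    rw [e, q]; ring
  have hdist (f₀ f₁ f₂ f₃ : ι → ι → ι → ℝ) (r : ℝ) :
      ∑ j, ∑ k, ∑ l, (r * f₀ j k l + (f₁ j k l + f₂ j k l + f₃ j k l))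
        = r * ∑ j, ∑ k, ∑ l, f₀ j k l + (∑ j, ∑ k, ∑ l, f₁ j k l + ∑ j, ∑ k, ∑ l, f₂ j k l
          + ∑ j, ∑ k, ∑ l, f₃ j k l) := by
    simp only [Finset.sum_add_distrib, Finset.mul_sum]
  rw [Finset.sum_congr rfl fun j _ => Finset.sum_congr rfl fun k _ =>
    Finset.sum_congr rfl fun l _ => hterm j k l, hdist, t₁, t₂, t₃, hquart, cubicInner]
  linear_combination -hsum

end SpaceForm

end StatGeom

namespace StatGeom

noncomputable section

/-! ### Derivatives along vector fields and smooth orthonormal frames. -/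

section VectorFieldDerivative

open Topology

variable {E : Type*} [NormedAddCommGroup E] [NormedSpace ℝ E] [FiniteDimensional ℝ E]
  {H : Type*} [TopologicalSpace H] {I : ModelWithCorners ℝ E H}
  {M : Type*} [TopologicalSpace M] [ChartedSpace H M] [IsManifold I ∞ M]

lemma mvfderiv_congr {f f' : M → ℝ} {x : M} (h : f =ᶠ[𝓝 x] f') :
    mvfderiv I f x = mvfderiv I f' x := by
  ext v
  simp only [mvfderiv, h.mfderiv_eq]
  rfl

lemma contMDiffAt_mlieBracket {X Y : Π x : M, TangentSpace I x} {x : M}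
    (hX : CMDiffAt ∞ (T% X) x) (hY : CMDiffAt ∞ (T% Y) x) :
    CMDiffAt ∞ (T% (mlieBracket I X Y)) x := by
  have := FiniteDimensional.complete ℝ E
  have : IsManifold I (minSmoothness ℝ 2) M := by
    rw [minSmoothness_of_isRCLikeNormedField]; infer_instance
  have : IsManifold I (((⊤ : ℕ∞) : ℕ∞ω) + 1) M := by simp; infer_instance
  refine ContMDiffAt.mlieBracket_vectorField (m := ⊤) (n := ⊤) hX hY ?_
  rw [minSmoothness_of_isRCLikeNormedField]
  simp

/-- A vector field acts on functions through the bracket: `[X, f Z] - f [X, Z] = (X f) Z`. -/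
lemma mvfderiv_mlieBracket {X Y Z : Π x : M, TangentSpace I x} {f : M → ℝ} {x : M}
    (hX : ∀ᶠ y in 𝓝 x, CMDiffAt ∞ (T% X) y) (hY : ∀ᶠ y in 𝓝 x, CMDiffAt ∞ (T% Y) y)
    (hZ : ∀ᶠ y in 𝓝 x, CMDiffAt ∞ (T% Z) y) (hf : ∀ᶠ y in 𝓝 x, CMDiffAt ∞ f y)
    (hXf : MDiffAt (fun y => mvfderiv I f y (X y)) x)
    (hYf : MDiffAt (fun y => mvfderiv I f y (Y y)) x) (hZ0 : Z x ≠ 0) :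
    mvfderiv I (fun y => mvfderiv I f y (Y y)) x (X x)
      - mvfderiv I (fun y => mvfderiv I f y (X y)) x (Y x)
      = mvfderiv I f x (mlieBracket I X Y x) := by
  have := FiniteDimensional.complete ℝ E
  have : IsManifold I (minSmoothness ℝ 3) M := by
    rw [minSmoothness_of_isRCLikeNormedField]; infer_instance
  have two {X : Π x : M, TangentSpace I x} (h : CMDiffAt ∞ (T% X) x) :
      CMDiffAt (minSmoothness ℝ 2) (T% X) x := by
    rw [minSmoothness_of_isRCLikeNormedField]; exact h.of_le ENat.LEInfty.out
  have mdz {X : Π x : M, TangentSpace I x} {y} (h : CMDiffAt ∞ (T% X) y) :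
      MDiffAt (T% X) y := h.mdifferentiableAt (by simp)
  have mdf {y} (h : CMDiffAt ∞ f y) : MDiffAt f y := h.mdifferentiableAt (by simp)
  have hX0 := hX.self_of_nhds
  have hY0 := hY.self_of_nhds
  have hZ0' := hZ.self_of_nhds
  have hf0 := hf.self_of_nhds
  have key {X : Π x : M, TangentSpace I x} :
      mlieBracket I X (f • Z) =ᶠ[𝓝 x]
        (fun y => mvfderiv I f y (X y)) • Z + f • mlieBracket I X Z := by
    filter_upwards [hZ, hf] with y h1 h2
    exact mlieBracket_smul_right (mdf h2) (mdz h1)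
  have outer {X Y : Π x : M, TangentSpace I x} (hY : CMDiffAt ∞ (T% Y) x)
      (hYf : MDiffAt (fun y => mvfderiv I f y (Y y)) x) :
      mlieBracket I X (mlieBracket I Y (f • Z)) x
        = mvfderiv I (fun y => mvfderiv I f y (Y y)) x (X x) • Z x
          + mvfderiv I f x (Y x) • mlieBracket I X Z x
          + (mvfderiv I f x (X x) • mlieBracket I Y Z x
          + f x • mlieBracket I X (mlieBracket I Y Z) x) := by
    rw [(Filter.EventuallyEq.refl (𝓝 x) X).mlieBracket_vectorField_eq key, 
      mlieBracket_add_right (hYf.smul_section (mdz hZ0'))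
        ((mdf hf0).smul_section (mdz (contMDiffAt_mlieBracket hY hZ0'))),
      mlieBracket_smul_right hYf (mdz hZ0'),
      mlieBracket_smul_right (mdf hf0) (mdz (contMDiffAt_mlieBracket hY hZ0'))]
  -- The Jacobi identity for `X, Y, f Z` minus `f` times the one for `X, Y, Z` leaves the asserted
  -- identity multiplied by `Z x`, which is nonzero.
  have j1 := leibniz_identity_mlieBracket_apply (two hX0) (two hY0)
    (two (hf0.smul_section hZ0'))
  have j2 := leibniz_identity_mlieBracket_apply (two hX0) (two hY0) (two hZ0')
  rw [outer hY0 hYf, outer hX0 hXf, mlieBracket_smul_right (mdf hf0) (mdz hZ0'), j2] at j1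
  have : (mvfderiv I (fun y => mvfderiv I f y (Y y)) x (X x)
      - mvfderiv I (fun y => mvfderiv I f y (X y)) x (Y x)
      - mvfderiv I f x (mlieBracket I X Y x)) • Z x = 0 := by
    rw [← sub_eq_zero.2 j1]
    module
  exact sub_eq_zero.1 ((smul_eq_zero.1 this).resolve_right hZ0)

variable [RiemannianBundle (fun x : M => TangentSpace I x)]
  [IsContMDiffRiemannianBundle I ∞ E (fun x : M => TangentSpace I x)]

lemma contMDiffAt_inner {X Y : Π x : M, TangentSpace I x} {x : M}
    (hX : CMDiffAt ∞ (T% X) x) (hY : CMDiffAt ∞ (T% Y) x) :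
    CMDiffAt ∞ (fun y => (inner ℝ (X y) (Y y) : ℝ)) x :=
  ContMDiffAt.inner_bundle (IB := I) (F := E) (E := fun x : M => TangentSpace I x) hX hY

/-- The derivative of a smooth function along a smooth unit vector field is smooth. -/
lemma contMDiffAt_mvfderiv {X : Π x : M, TangentSpace I x} {f : M → ℝ} {x : M}
    (hX : ∀ᶠ y in 𝓝 x, CMDiffAt ∞ (T% X) y) (hf : ∀ᶠ y in 𝓝 x, CMDiffAt ∞ f y)
    (hunit : ∀ᶠ y in 𝓝 x, inner ℝ (X y) (X y) = (1 : ℝ)) :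
    CMDiffAt ∞ (fun y => mvfderiv I f y (X y)) x := by
  have := FiniteDimensional.complete ℝ E
  -- For a unit field, `X f = g([X, f X], X)`, and brackets of smooth fields are smooth.
  have h := contMDiffAt_inner (contMDiffAt_mlieBracket hX.self_of_nhds
    (hf.self_of_nhds.smul_section hX.self_of_nhds)) hX.self_of_nhds
  refine h.congr_of_eventuallyEq ?_
  filter_upwards [hX, hf, hunit] with y h1 h2 h3
  rw [mlieBracket_smul_right (h2.mdifferentiableAt (by simp)) (h1.mdifferentiableAt (by simp)),
    mlieBracket_self]
  simp only [Pi.zero_apply, smul_zero, add_zero, inner_smul_left, h3, RCLike.conj_to_real, mul_one]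

open InnerProductSpace in
lemma contMDiffAt_gramSchmidt {ι : Type*} [LinearOrder ι] [LocallyFiniteOrderBot ι]
    [WellFoundedLT ι] {s : ι → Π x : M, TangentSpace I x} {x : M}
    (hs : ∀ i, CMDiffAt ∞ (T% (s i)) x) (hli : LinearIndependent ℝ (s · x)) (i : ι) :
    CMDiffAt ∞ (T% (fun y => (gramSchmidt ℝ (s · y) i : TangentSpace I y))) x := by
  induction i using WellFoundedLT.induction with
  | ind i ih =>
    set r : Π y : M, TangentSpace I y := fun y => ∑ j ∈ Finset.Iio i,
      ((fun y => (inner ℝ (gramSchmidt ℝ (s · y) j) (s i y) : ℝ)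
          / inner ℝ (gramSchmidt ℝ (s · y) j) (gramSchmidt ℝ (s · y) j)) •
        fun y => (gramSchmidt ℝ (s · y) j : TangentSpace I y)) y
    have e (y) : gramSchmidt ℝ (s · y) i = (s i - r) y := by
      rw [gramSchmidt_def]
      simp only [Submodule.starProjection_singleton, Pi.sub_apply, Pi.smul_apply',
        real_inner_self_eq_norm_sq, r]
      rfl
    suffices h : CMDiffAt ∞ (T% (s i - r)) x from
      h.congr_of_eventuallyEq (Filter.Eventually.of_forall fun y => congrArg (TotalSpace.mk y) (e y))
    refine (hs i).sub_section (ContMDiffAt.sum_section fun j hj => ?_)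
    have hj' := ih j (Finset.mem_Iio.1 hj)
    refine ContMDiffAt.smul_section ?_ hj'
    refine ContMDiffAt.div₀ (contMDiffAt_inner hj' (hs i)) (contMDiffAt_inner hj' hj') ?_
    exact inner_self_ne_zero.2 (gramSchmidt_ne_zero j hli)

open InnerProductSpace in
lemma contMDiffAt_gramSchmidtNormed {ι : Type*} [LinearOrder ι] [LocallyFiniteOrderBot ι]
    [WellFoundedLT ι] {s : ι → Π x : M, TangentSpace I x} {x : M}
    (hs : ∀ i, CMDiffAt ∞ (T% (s i)) x) (hli : LinearIndependent ℝ (s · x)) (i : ι) :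
    CMDiffAt ∞ (T% (fun y => (gramSchmidtNormed ℝ (s · y) i : TangentSpace I y))) x := by
  have h := contMDiffAt_gramSchmidt hs hli i
  have h0 : (inner ℝ (gramSchmidt ℝ (s · x) i) (gramSchmidt ℝ (s · x) i) : ℝ) ≠ 0 :=
    inner_self_ne_zero.2 (gramSchmidt_ne_zero i hli)
  have hn : CMDiffAt ∞ (fun y => (‖gramSchmidt ℝ (s · y) i‖)⁻¹) x := by
    have e : (fun y => (‖gramSchmidt ℝ (s · y) i‖)⁻¹) = (fun t : ℝ => (√t)⁻¹) ∘
        fun y => (inner ℝ (gramSchmidt ℝ (s · y) i) (gramSchmidt ℝ (s · y) i) : ℝ) := by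
      funext y
      exact congrArg (·⁻¹) (norm_eq_sqrt_real_inner _)
    rw [e]
    refine ContMDiffAt.comp x (ContDiffAt.contMDiffAt ?_) (contMDiffAt_inner h h)
    refine ContDiffAt.inv (contDiffAt_id.sqrt h0) ?_
    exact (Real.sqrt_ne_zero real_inner_self_nonneg).2 h0
  exact hn.smul_section h

variable (I) in
/-- A family of smooth vector fields which is orthonormal at the points of an open set. -/
structure IsOrthonormalFrameOn {ι : Type*} [Fintype ι] (U : Set M)
    (e : ι → Π x : M, TangentSpace I x) : Prop where
  isOpen : IsOpen U
  smooth : ∀ i, CMDiff ∞ (T% (e i))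
  orthonormal : ∀ x ∈ U, Orthonormal ℝ (e · x)
  card : Fintype.card ι = Module.finrank ℝ E

variable (I) in
/-- Every point has a neighbourhood with an orthonormal frame that extends the orthonormal basis
`onb I x`. -/
lemma exists_orthonormalFrame [T2Space M] (x : M) :
    ∃ (U : Set M) (e : Fin (Module.finrank ℝ (TangentSpace I x)) → Π y : M, TangentSpace I y),
      x ∈ U ∧ IsOrthonormalFrameOn I U e ∧ ∀ i, e i x = onb I x i := by
  set t := trivializationAt E (TangentSpace I) x
  have hx : x ∈ t.baseSet := FiberBundle.mem_baseSet_trivializationAt' x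
  set b := (onb I x).toBasis.map (t.linearEquivAt ℝ x hx) with hb
  set s := t.localFrame b
  have hs := t.isLocalFrameOn_localFrame_baseSet I ∞ b
  have hsx (i) : s i x = onb I x i := by
    refine (t.localFrame_apply_of_mem_baseSet b hx).trans ?_
    rw [Trivialization.basisAt, hb]
    simp [hx]
  set g : Fin (Module.finrank ℝ (TangentSpace I x)) → Π y : M, TangentSpace I y :=
    fun i y => InnerProductSpace.gramSchmidtNormed ℝ (s · y) i
  -- The bump function makes the frame fields globally smooth, as `HasCurvature` tests only global
  -- fields. Orthonormality is retained where the function equals one. At `x` Gram–Schmidt leaves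
  -- the orthonormal basis unchanged.
  obtain ⟨ρ, -, hρ⟩ := (SmoothBumpFunction.nhds_basis_tsupport (I := I) x).mem_iff.1
    (t.open_baseSet.mem_nhds hx)
  have hev := ρ.eventuallyEq_one
  obtain ⟨U, hU, hUo, hxU⟩ := eventually_nhds_iff.1
    (hev.and (t.open_baseSet.mem_nhds hx))
  have hon (y) (hy : y ∈ U) : Orthonormal ℝ (g · y) :=
    InnerProductSpace.gramSchmidtNormed_orthonormal (hs.linearIndependent (hU y hy).2)
  have hgx (i) : g i x = onb I x i := by
    have : (s · x) = onb I x := funext hsx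
    simp only [g, this, InnerProductSpace.gramSchmidtNormed]
    rw [InnerProductSpace.gramSchmidt_of_orthogonal]
    · simp
    · exact fun i j h => (onb I x).orthonormal.2 h
  have hval (i) (y) (hy : y ∈ U) : ((ρ : M → ℝ) • g i) y = g i y := by
    simp [(hU y hy).1]
  refine ⟨U, fun i => (ρ : M → ℝ) • g i, hxU, ⟨hUo, fun i => ?_, fun y hy => ?_, ?_⟩, fun i => ?_⟩
  · refine ContMDiffOn.smul_section_of_tsupport ρ.contMDiff.contMDiffOn t.open_baseSet hρ ?_
    intro y hy
    exact (contMDiffAt_gramSchmidtNormed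
      (fun i => (hs.contMDiffOn i).contMDiffAt (t.open_baseSet.mem_nhds hy))
      (hs.linearIndependent hy) i).contMDiffWithinAt
  · simpa only [hval _ y hy] using hon y hy
  · simp; rfl
  · exact (hval i x hxU).trans (hgx i)

end VectorFieldDerivative

end

end StatGeom

namespace StatGeom

noncomputable section

/-! ### Independence of the orthonormal basis. -/

section OrthonormalInvariance

variable {V : Type*} [NormedAddCommGroup V] [InnerProductSpace ℝ V] [FiniteDimensional ℝ V]
  {ι κ : Type*} [Fintype ι] [Fintype κ]

lemma sum_sq_linear_eq (b : OrthonormalBasis ι ℝ V) (c : OrthonormalBasis κ ℝ V)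
    (φ : V →ₗ[ℝ] ℝ) : ∑ i, φ (b i) ^ 2 = ∑ k, φ (c k) ^ 2 := by
  have := FiniteDimensional.complete ℝ V
  obtain ⟨w, hw⟩ := (InnerProductSpace.toDual ℝ V).surjective φ.toContinuousLinearMap
  have hφ (v) : φ v = inner ℝ w v := by
    rw [← InnerProductSpace.toDual_apply_apply (𝕜 := ℝ), hw]; rfl
  simp only [hφ]
  refine Eq.trans (b := ‖w‖ ^ 2) ?_ (Eq.symm ?_)
  · rw [← real_inner_self_eq_norm_sq, ← b.sum_inner_mul_inner w w]
    exact Finset.sum_congr rfl fun i _ => by rw [real_inner_comm w (b i), sq]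
  · rw [← real_inner_self_eq_norm_sq, ← c.sum_inner_mul_inner w w]
    exact Finset.sum_congr rfl fun i _ => by rw [real_inner_comm w (c i), sq]

lemma sum_bilinear_eq (b : OrthonormalBasis ι ℝ V) (c : OrthonormalBasis κ ℝ V)
    (B : V →ₗ[ℝ] V →ₗ[ℝ] ℝ) : ∑ i, B (b i) (b i) = ∑ k, B (c k) (c k) := by
  classical
  have h (i) : B (b i) (b i)
      = ∑ k, ∑ l, inner ℝ (c k) (b i) * inner ℝ (b i) (c l) * B (c k) (c l) := by
    conv_lhs => rw [← c.sum_repr' (b i)]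
    simp only [map_sum, LinearMap.sum_apply, map_smul, LinearMap.smul_apply, smul_eq_mul,
      Finset.mul_sum]
    rw [Finset.sum_comm]
    refine Finset.sum_congr rfl fun k _ => Finset.sum_congr rfl fun l _ => ?_
    rw [real_inner_comm (c l) (b i)]; ring
  simp only [h]
  rw [Finset.sum_comm]
  refine Finset.sum_congr rfl fun k _ => ?_
  rw [Finset.sum_comm]
  simp only [← Finset.sum_mul, b.sum_inner_mul_inner]
  simp [c.inner_eq_ite]

end OrthonormalInvariance

open Topology

variable {E : Type*} [NormedAddCommGroup E] [NormedSpace ℝ E] [FiniteDimensional ℝ E]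
  {H : Type*} [TopologicalSpace H] {I : ModelWithCorners ℝ E H}
  {M : Type*} [TopologicalSpace M] [ChartedSpace H M] [IsManifold I ∞ M]

/-! ### The algebra of smooth functions on an open set and its frame derivations. -/

section SmoothFunctions

variable (I) in
/-- The algebra of functions on a set `U` that extend to functions on `M` smooth at the points of
`U`. -/
def smoothFunctionsOn (U : Set M) : Subalgebra ℝ (U → ℝ) where
  carrier := {f | ∃ F : M → ℝ, (∀ y ∈ U, CMDiffAt ∞ F y) ∧ ∀ y : U, f y = F y}
  mul_mem' := by
    rintro f g ⟨F, hF, hf⟩ ⟨G, hG, hg⟩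
    exact ⟨F * G, fun y hy => (hF y hy).mul (hG y hy), fun y => by simp [hf, hg]⟩
  add_mem' := by
    rintro f g ⟨F, hF, hf⟩ ⟨G, hG, hg⟩
    exact ⟨F + G, fun y hy => (hF y hy).add (hG y hy), fun y => by simp [hf, hg]⟩
  algebraMap_mem' r := ⟨fun _ => r, fun _ _ => contMDiffAt_const, fun _ => rfl⟩

namespace smoothFunctionsOn

variable {U : Set M}

/-- The restriction to `U` of a function smooth at the points of `U`. -/
def mk (F : M → ℝ) (hF : ∀ y ∈ U, CMDiffAt ∞ F y) : smoothFunctionsOn I U :=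
  ⟨fun y => F y, F, hF, fun _ => rfl⟩

/-- An extension to `M`. -/
def lift (f : smoothFunctionsOn I U) : M → ℝ := f.2.choose

lemma lift_smooth (f : smoothFunctionsOn I U) {y : M} (hy : y ∈ U) : CMDiffAt ∞ (smoothFunctionsOn.lift f) y :=
  f.2.choose_spec.1 y hy

lemma lift_apply (f : smoothFunctionsOn I U) (y : U) : (smoothFunctionsOn.lift f) y = f.1 y :=
  (f.2.choose_spec.2 y).symm

lemma lift_mdifferentiableAt (f : smoothFunctionsOn I U) {y : M} (hy : y ∈ U) :
    MDiffAt (smoothFunctionsOn.lift f) y :=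
  (smoothFunctionsOn.lift_smooth f hy).mdifferentiableAt (by simp)

@[ext] lemma ext {f g : smoothFunctionsOn I U} (h : ∀ y, f.1 y = g.1 y) : f = g :=
  Subtype.ext (funext h)

/-- Evaluation at a point. -/
def eval (y : U) : smoothFunctionsOn I U →ₐ[ℝ] ℝ :=
  (Pi.evalAlgHom ℝ (fun _ : U => ℝ) y).comp (smoothFunctionsOn I U).val

lemma eval_apply (y : U) (f : smoothFunctionsOn I U) : eval y f = f.1 y := rfl

end smoothFunctionsOn

end SmoothFunctions

variable [RiemannianBundle (fun x : M => TangentSpace I x)]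
  [IsContMDiffRiemannianBundle I ∞ E (fun x : M => TangentSpace I x)]

namespace IsOrthonormalFrameOn

variable {ι : Type*} [Fintype ι] {U : Set M} {e : ι → Π x : M, TangentSpace I x}
  (he : IsOrthonormalFrameOn I U e)

include he

lemma mdifferentiableAt (a : ι) (x : M) : MDiffAt (T% (e a)) x :=
  (he.smooth a x).mdifferentiableAt (by simp)

lemma eventually_mem {x : M} (hx : x ∈ U) : ∀ᶠ y in 𝓝 x, y ∈ U := he.isOpen.mem_nhds hx

lemma inner_eq [DecidableEq ι] {x : M} (hx : x ∈ U) (a b : ι) :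
    (inner ℝ (e a x) (e b x) : ℝ) = if a = b then 1 else 0 :=
  orthonormal_iff_ite.1 (he.orthonormal x hx) a b

/-- The orthonormal basis of the tangent space given by the frame. -/
def basis {x : M} (hx : x ∈ U) : OrthonormalBasis ι ℝ (TangentSpace I x) :=
  OrthonormalBasis.mk (he.orthonormal x hx)
    ((he.orthonormal x hx).linearIndependent.span_eq_top_of_card_eq_finrank' he.card).ge

lemma basis_apply {x : M} (hx : x ∈ U) (a : ι) : he.basis hx a = e a x := by
  simp [basis]

lemma sum_inner_smul {x : M} (hx : x ∈ U) (v : TangentSpace I x) :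
    ∑ a, (inner ℝ (e a x) v : ℝ) • e a x = v := by
  conv_rhs => rw [← (he.basis hx).sum_repr' v]
  simp only [basis_apply]

lemma mvfderiv_inner_eq_zero (a b : ι) {x : M} (hx : x ∈ U) :
    mvfderiv I (fun y => (inner ℝ (e a y) (e b y) : ℝ)) x = 0 := by
  classical
  have : (fun y => (inner ℝ (e a y) (e b y) : ℝ)) =ᶠ[𝓝 x] fun _ => if a = b then 1 else 0 := by
    filter_upwards [he.eventually_mem hx] with y hy using he.inner_eq hy a b
  rw [mvfderiv_congr this, mvfderiv_const]

lemma contMDiffAt_deriv (a : ι) {f : M → ℝ} (hf : ∀ y ∈ U, CMDiffAt ∞ f y) {x : M} (hx : x ∈ U) :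
    CMDiffAt ∞ (fun y => mvfderiv I f y (e a y)) x := by
  classical
  refine contMDiffAt_mvfderiv (Filter.Eventually.of_forall fun y => he.smooth a y) ?_ ?_
  · filter_upwards [he.eventually_mem hx] with y hy using hf y hy
  · filter_upwards [he.eventually_mem hx] with y hy
    rw [he.inner_eq hy, if_pos rfl]

/-- The derivation of the algebra of smooth functions on `U` given by a frame field. -/
def deriv (a : ι) : Derivation ℝ (smoothFunctionsOn I U) (smoothFunctionsOn I U) :=
  -- The extension is an arbitrary choice; since `U` is open, the derivative at its points depends
  -- only on the values on `U`.
  have congr (f : smoothFunctionsOn I U) (F : M → ℝ) (h : ∀ y : U, F y = f.1 y) (y : U) :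
      mvfderiv I (smoothFunctionsOn.lift f) y.1 (e a y.1) = mvfderiv I F y.1 (e a y.1) := by
    rw [mvfderiv_congr]
    filter_upwards [he.eventually_mem y.2] with z hz
    rw [smoothFunctionsOn.lift_apply f ⟨z, hz⟩, ← h ⟨z, hz⟩]
  Derivation.mk'
    { toFun := fun f => smoothFunctionsOn.mk (I := I) (fun y => mvfderiv I (smoothFunctionsOn.lift f) y (e a y))
        fun _ hy => he.contMDiffAt_deriv a (fun _ => smoothFunctionsOn.lift_smooth f) hy
      map_add' := fun f g => by
        ext y
        change mvfderiv I (smoothFunctionsOn.lift (f + g)) y.1 (e a y.1)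
          = mvfderiv I (smoothFunctionsOn.lift f) y.1 (e a y.1) + mvfderiv I (smoothFunctionsOn.lift g) y.1 (e a y.1)
        rw [congr (f + g) ((smoothFunctionsOn.lift f) + (smoothFunctionsOn.lift g)) fun z => by
          simp [smoothFunctionsOn.lift_apply],
          mvfderiv_add (smoothFunctionsOn.lift_mdifferentiableAt f y.2)
            (smoothFunctionsOn.lift_mdifferentiableAt g y.2)]
        rfl
      map_smul' := fun r f => by
        ext y
        change mvfderiv I (smoothFunctionsOn.lift (r • f)) y.1 (e a y.1) = r * mvfderiv I (smoothFunctionsOn.lift f) y.1 (e a y.1)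
        rw [congr (r • f) ((fun _ => r) * (smoothFunctionsOn.lift f)) fun z => by
          simp [smoothFunctionsOn.lift_apply],
          mvfderiv_mul mdifferentiableAt_const (smoothFunctionsOn.lift_mdifferentiableAt f y.2),
          mvfderiv_const]
        simp }
    fun f g => by
      ext y
      change mvfderiv I (smoothFunctionsOn.lift (f * g)) y.1 (e a y.1)
        = f.1 y * mvfderiv I (smoothFunctionsOn.lift g) y.1 (e a y.1) + g.1 y * mvfderiv I (smoothFunctionsOn.lift f) y.1 (e a y.1)
      rw [congr (f * g) ((smoothFunctionsOn.lift f) * (smoothFunctionsOn.lift g)) fun z => by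
        simp [smoothFunctionsOn.lift_apply],
        mvfderiv_mul (smoothFunctionsOn.lift_mdifferentiableAt f y.2)
          (smoothFunctionsOn.lift_mdifferentiableAt g y.2),
        ← smoothFunctionsOn.lift_apply f, ← smoothFunctionsOn.lift_apply g]
      simp

lemma deriv_apply (a : ι) {f : smoothFunctionsOn I U} {F : M → ℝ} (h : ∀ y : U, F y = f.1 y)
    (y : U) : (he.deriv a f).1 y = mvfderiv I F y.1 (e a y.1) := by
  change mvfderiv I (smoothFunctionsOn.lift f) y.1 (e a y.1) = _
  rw [mvfderiv_congr]
  filter_upwards [he.eventually_mem y.2] with z hz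
  rw [smoothFunctionsOn.lift_apply f ⟨z, hz⟩, ← h ⟨z, hz⟩]

lemma deriv_deriv_apply (a b : ι) {f : smoothFunctionsOn I U} {F : M → ℝ}
    (h : ∀ y : U, F y = f.1 y) (y : U) : (he.deriv a (he.deriv b f)).1 y
      = mvfderiv I (fun z => mvfderiv I F z (e b z)) y.1 (e a y.1) :=
  he.deriv_apply a (fun z => (he.deriv_apply b h z).symm) y

end IsOrthonormalFrameOn

end

end StatGeom

namespace StatGeom

noncomputable section

open Topology

variable {E : Type*} [NormedAddCommGroup E] [NormedSpace ℝ E] [FiniteDimensional ℝ E]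
  {H : Type*} [TopologicalSpace H] {I : ModelWithCorners ℝ E H}
  {M : Type*} [TopologicalSpace M] [ChartedSpace H M] [IsManifold I ∞ M]
  [RiemannianBundle (fun x : M => TangentSpace I x)]
  [IsContMDiffRiemannianBundle I ∞ E (fun x : M => TangentSpace I x)]

/-! ### Multilinearity and symmetry of the cubic form. -/

section CubicTensor

variable {nab : CovariantDerivative I E (fun x : M => TangentSpace I x)}

lemma cubicForm_swap_left (h : IsStatistical nab) (x : M) (X Y Z : TangentSpace I x) :
    cubicForm nab x X Y Z = cubicForm nab x Y X Z := by
  rw [cubicForm, h.symmetric, cubicForm]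

lemma cubicForm_swap_right (x : M) (X Y Z : TangentSpace I x) :
    cubicForm nab x X Y Z = cubicForm nab x X Z Y := by
  have hd (v : TangentSpace I x) := FiberBundle.mdifferentiableAt_extend I E v
  have hv (v : TangentSpace I x) : FiberBundle.extend E v x = v := by simp
  have h1 := nablaMetric_apply nab (X := FiberBundle.extend E X) (hd Y) (hd Z)
  have h2 := nablaMetric_apply nab (X := FiberBundle.extend E X) (hd Z) (hd Y)
  rw [mvfderiv_inner_comm] at h2
  simp only [hv] at h1 h2
  rw [cubicForm, cubicForm, h1, h2, real_inner_comm Y, real_inner_comm _ Z]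
  ring

lemma cubicForm_rotate (h : IsStatistical nab) (x : M) (X Y Z : TangentSpace I x) :
    cubicForm nab x X Y Z = cubicForm nab x Z X Y := by
  rw [cubicForm_swap_right, cubicForm_swap_left h]

/-- The cubic form as a linear form in its first argument. -/
def cubicFormLinear (nab : CovariantDerivative I E (fun x : M => TangentSpace I x)) (x : M)
    (Y Z : TangentSpace I x) : TangentSpace I x →ₗ[ℝ] ℝ where
  toFun X := cubicForm nab x X Y Z
  map_add' X X' := by simp only [cubicForm, nablaMetric, map_add, mul_add]
  map_smul' r X := by
    simp only [cubicForm, nablaMetric, map_smul, smul_eq_mul, RingHom.id_apply]; ring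

lemma cubicForm_add_left (x : M) (X X' Y Z : TangentSpace I x) :
    cubicForm nab x (X + X') Y Z = cubicForm nab x X Y Z + cubicForm nab x X' Y Z :=
  map_add (cubicFormLinear nab x Y Z) X X'

lemma cubicForm_smul_left (x : M) (r : ℝ) (X Y Z : TangentSpace I x) :
    cubicForm nab x (r • X) Y Z = r * cubicForm nab x X Y Z :=
  map_smul (cubicFormLinear nab x Y Z) r X

lemma cubicForm_sum_left {κ : Type*} (s : Finset κ) (x : M) (X : κ → TangentSpace I x)
    (Y Z : TangentSpace I x) :
    cubicForm nab x (∑ i ∈ s, X i) Y Z = ∑ i ∈ s, cubicForm nab x (X i) Y Z :=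
  map_sum (cubicFormLinear nab x Y Z) X s

end CubicTensor

/-- The coefficients `g(∇_{e_a} e_b, e_m)` of a connection in a frame. -/
def connCoeff (nab : CovariantDerivative I E (fun x : M => TangentSpace I x)) {ι : Type*}
    (e : ι → Π x : M, TangentSpace I x) (a b m : ι) (y : M) : ℝ :=
  inner ℝ (nab (e b) y (e a y)) (e m y)

/-- The components of the cubic form in a frame. -/
def cubicCoeff (nab : CovariantDerivative I E (fun x : M => TangentSpace I x)) {ι : Type*}
    (e : ι → Π x : M, TangentSpace I x) (a b c : ι) (y : M) : ℝ :=
  cubicForm nab y (e a y) (e b y) (e c y)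

lemma contMDiffAt_nab {nab : CovariantDerivative I E (fun x : M => TangentSpace I x)}
    (hstat : IsStatistical nab) {X Y : Π x : M, TangentSpace I x} (hX : CMDiff ∞ (T% X))
    (hY : CMDiff ∞ (T% Y)) (x : M) : CMDiffAt ∞ (T% (fun y => nab Y y (X y))) x := by
  have h := hstat.smooth.contMDiff.contMDiff (σ := Y) hY.contMDiffOn
  exact ContMDiffAt.clm_bundle_apply (h.contMDiffAt Filter.univ_mem) (hX x)

/-! ### Structure equations of a statistical connection in an orthonormal frame. -/

namespace IsOrthonormalFrameOn

variable {ι : Type*} [Fintype ι] {U : Set M} {e : ι → Π x : M, TangentSpace I x}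
  (he : IsOrthonormalFrameOn I U e)
  {nab : CovariantDerivative I E (fun x : M => TangentSpace I x)} (hstat : IsStatistical nab)

include he

lemma sum_connCoeff_smul (cov : CovariantDerivative I E (fun x : M => TangentSpace I x)) (a b : ι)
    {x : M} (hx : x ∈ U) : cov (e b) x (e a x) = ∑ m, connCoeff cov e a b m x • e m x := by
  conv_lhs => rw [← he.sum_inner_smul hx (cov (e b) x (e a x))]
  exact Finset.sum_congr rfl fun m _ => by rw [connCoeff, real_inner_comm]

/-- The products `g(e_b, e_c)` are constant on `U`, so `∇g` involves only connection coefficients.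
Smoothness of the cubic form follows from that of `∇`. -/
lemma cubicCoeff_eq (a b c : ι) {x : M} (hx : x ∈ U) :
    cubicCoeff nab e a b c x = 1 / 2 * (connCoeff nab e a b c x + connCoeff nab e a c b x) := by
  have h := nablaMetric_apply nab (X := e a) (he.mdifferentiableAt b x) (he.mdifferentiableAt c x)
  rw [he.mvfderiv_inner_eq_zero b c hx, zero_apply] at h
  rw [cubicCoeff, cubicForm, h, connCoeff, connCoeff, real_inner_comm _ (e b x)]
  ring

lemma connCoeff_eq_add (hstat : IsStatistical nab) (a b c : ι) (x : M) :
    connCoeff nab e a b c x = connCoeff (leviCivita I M) e a b c x + cubicCoeff nab e a b c x := by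
  rw [cubicCoeff, cubicForm_eq nab hstat (he.mdifferentiableAt a x) (he.mdifferentiableAt b x)
    (he.mdifferentiableAt c x), inner_sub_left, connCoeff, connCoeff]
  ring

lemma connCoeff_leviCivita_skew (a b c : ι) {x : M} (hx : x ∈ U) :
    connCoeff (leviCivita I M) e a b c x = - connCoeff (leviCivita I M) e a c b x := by
  have h := (leviCivita_isMetricCompatible (I := I) (M := M)).mvfderiv_inner_eq (e a)
    (he.mdifferentiableAt b x) (he.mdifferentiableAt c x)
  rw [he.mvfderiv_inner_eq_zero b c hx, zero_apply] at h
  dsimp only at h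
  rw [connCoeff, connCoeff, real_inner_comm (e b x)]
  linarith

omit [Fintype ι] he in
lemma cubicCoeff_swap_left (hstat : IsStatistical nab) (a b c : ι) (x : M) :
    cubicCoeff nab e a b c x = cubicCoeff nab e b a c x :=
  cubicForm_swap_left hstat x _ _ _

omit [Fintype ι] he in
lemma cubicCoeff_swap_right (a b c : ι) (x : M) :
    cubicCoeff nab e a b c x = cubicCoeff nab e a c b x :=
  cubicForm_swap_right x _ _ _

lemma contMDiffAt_connCoeff (hstat : IsStatistical nab) (a b c : ι) (x : M) :
    CMDiffAt ∞ (connCoeff nab e a b c) x :=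
  contMDiffAt_inner (contMDiffAt_nab hstat (he.smooth a) (he.smooth b) x) (he.smooth c x)

lemma contMDiffAt_cubicCoeff (hstat : IsStatistical nab) (a b c : ι) {x : M} (hx : x ∈ U) :
    CMDiffAt ∞ (cubicCoeff nab e a b c) x := by
  have h : CMDiffAt ∞ (fun y => (1 / 2 : ℝ) * (connCoeff nab e a b c y + connCoeff nab e a c b y)) x :=
    contMDiffAt_const.mul ((he.contMDiffAt_connCoeff hstat a b c x).add
      (he.contMDiffAt_connCoeff hstat a c b x))
  refine h.congr_of_eventuallyEq ?_
  filter_upwards [he.eventually_mem hx] with y hy using he.cubicCoeff_eq a b c hy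

/-- The Koszul construction of `∇̂` carries no smoothness statement; its coefficients are smooth as
those of `∇` minus those of `A`. -/
lemma contMDiffAt_connCoeff_leviCivita (hstat : IsStatistical nab) (a b c : ι) {x : M}
    (hx : x ∈ U) : CMDiffAt ∞ (connCoeff (leviCivita I M) e a b c) x := by
  have h : CMDiffAt ∞ (fun y => connCoeff nab e a b c y - cubicCoeff nab e a b c y) x :=
    (he.contMDiffAt_connCoeff hstat a b c x).sub (he.contMDiffAt_cubicCoeff hstat a b c hx)
  refine h.congr_of_eventuallyEq (Filter.Eventually.of_forall fun y => ?_)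
  dsimp only
  rw [he.connCoeff_eq_add hstat]; ring

lemma sum_cubicCoeff_eq_zero (hstat : IsStatistical nab) (htr : IsTraceFree nab) (c : ι) {x : M}
    (hx : x ∈ U) : ∑ a, cubicCoeff nab e a a c x = 0 := by
  have h := sum_bilinear_eq (he.basis hx) (onb I x)
    (LinearMap.mk₂ ℝ (fun Y Z => cubicForm nab x (e c x) Y Z)
      (fun _ _ _ => by simp only [cubicForm_swap_left hstat x (e c x), cubicForm_add_left])
      (fun _ _ _ => by
        simp only [cubicForm_swap_left hstat x (e c x), cubicForm_smul_left, smul_eq_mul])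
      (fun _ _ _ => by simp only [cubicForm_rotate hstat x (e c x), cubicForm_add_left])
      (fun _ _ _ => by
        simp only [cubicForm_rotate hstat x (e c x), cubicForm_smul_left, smul_eq_mul]))
  simp only [LinearMap.mk₂_apply, basis_apply] at h
  rw [← htr x (e c x), czebyshev, ← h]
  refine Finset.sum_congr rfl fun a _ => ?_
  rw [cubicCoeff, cubicForm_swap_right, cubicForm_swap_left hstat]

lemma normSqCubicForm_eq (hstat : IsStatistical nab) {x : M} (hx : x ∈ U) :
    normSqCubicForm nab x = ∑ a, ∑ b, ∑ c, cubicCoeff nab e a b c x ^ 2 := by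
  have h1 (Y Z : TangentSpace I x) : ∑ k, cubicForm nab x (onb I x k) Y Z ^ 2
      = ∑ c, cubicForm nab x (e c x) Y Z ^ 2 := by
    have := sum_sq_linear_eq (he.basis hx) (onb I x) (cubicFormLinear nab x Y Z)
    simp only [basis_apply] at this
    exact this.symm
  have h2 (X Z : TangentSpace I x) : ∑ k, cubicForm nab x X (onb I x k) Z ^ 2
      = ∑ c, cubicForm nab x X (e c x) Z ^ 2 := by
    simp only [cubicForm_swap_left hstat x X, h1]
  have h3 (X Y : TangentSpace I x) : ∑ k, cubicForm nab x X Y (onb I x k) ^ 2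
      = ∑ c, cubicForm nab x X Y (e c x) ^ 2 := by
    simp only [cubicForm_swap_right x X Y, h2]
  simp only [normSqCubicForm, h3]
  rw [Finset.sum_congr rfl fun i _ => (Finset.sum_comm.trans
    (Finset.sum_congr rfl fun c _ => h2 (onb I x i) (e c x))), Finset.sum_comm]
  rw [Finset.sum_congr rfl fun c _ => (Finset.sum_comm.trans
    (Finset.sum_congr rfl fun b _ => h1 (e b x) (e c x)))]
  simp only [cubicCoeff]
  rw [Finset.sum_comm, Finset.sum_congr rfl fun b _ => Finset.sum_comm, Finset.sum_comm]

lemma mlieBracket_eq (a b : ι) {x : M} (hx : x ∈ U) :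
    mlieBracket I (e a) (e b) x = ∑ m, (connCoeff (leviCivita I M) e a b m x
      - connCoeff (leviCivita I M) e b a m x) • e m x := by
  have := FiniteDimensional.complete ℝ E
  have h := (CovariantDerivative.torsion_eq_zero_iff _).1 (leviCivita_torsion (I := I) (M := M))
    (he.mdifferentiableAt a x) (he.mdifferentiableAt b x)
  rw [← h, he.sum_connCoeff_smul _ a b hx, he.sum_connCoeff_smul _ b a hx,
    ← Finset.sum_sub_distrib]
  simp only [sub_smul]

/-- The product rule for `g(∇_b e_c, e_m)` has the defect `∇g = -2A`; `cubicCoeff_eq` absorbs it and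
turns the coefficient `a m k` into `a k m`. -/
lemma inner_nab_nab (hstat : IsStatistical nab) (a b c m : ι) {x : M} (hx : x ∈ U) :
    (inner ℝ (nab (fun y => nab (e c) y (e b y)) x (e a x)) (e m x) : ℝ)
      = mvfderiv I (connCoeff nab e b c m) x (e a x)
        + ∑ k, connCoeff nab e b c k x * connCoeff nab e a k m x := by
  have hN := (contMDiffAt_nab hstat (he.smooth b) (he.smooth c) x).mdifferentiableAt (by simp)
  have h := nablaMetric_apply nab (X := e a) hN (he.mdifferentiableAt m x)
  have h2 : nablaMetric nab x (e a x) (nab (e c) x (e b x)) (e m x)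
      = ∑ k, connCoeff nab e b c k x * (-2 * cubicCoeff nab e a k m x) := by
    have h3 (X Y Z : TangentSpace I x) : nablaMetric nab x X Y Z = -2 * cubicForm nab x X Y Z := by
      rw [cubicForm]; ring
    rw [h3, he.sum_connCoeff_smul _ b c hx, cubicForm_swap_left hstat, cubicForm_sum_left,
      Finset.mul_sum]
    refine Finset.sum_congr rfl fun k _ => ?_
    rw [cubicForm_smul_left, cubicForm_swap_left hstat, cubicCoeff]
    ring
  have h4 : (inner ℝ (nab (e c) x (e b x)) (nab (e m) x (e a x)) : ℝ)
      = ∑ k, connCoeff nab e b c k x * connCoeff nab e a m k x := by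
    conv_lhs => rw [he.sum_connCoeff_smul _ b c hx]
    simp only [sum_inner, real_inner_smul_left]
    exact Finset.sum_congr rfl fun k _ => by rw [connCoeff, connCoeff, real_inner_comm (nab (e m) x (e a x))]
  change nablaMetric nab x (e a x) (nab (e c) x (e b x)) (e m x)
    = mvfderiv I (connCoeff nab e b c m) x (e a x) - _ - _ at h
  rw [h2, h4] at h
  rw [← sub_eq_iff_eq_add']
  have h5 : ∑ k, connCoeff nab e b c k x * connCoeff nab e a k m x
      = -∑ k, connCoeff nab e b c k x * (-2 * cubicCoeff nab e a k m x)
        - ∑ k, connCoeff nab e b c k x * connCoeff nab e a m k x := by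
    rw [← Finset.sum_neg_distrib, ← Finset.sum_sub_distrib]
    refine Finset.sum_congr rfl fun k _ => ?_
    rw [he.cubicCoeff_eq a k m hx]; ring
  rw [h5]
  linarith

lemma inner_curvature (hstat : IsStatistical nab) (a b c m : ι) {x : M} (hx : x ∈ U) :
    (inner ℝ (curvature nab (e a) (e b) (e c) x) (e m x) : ℝ)
      = mvfderiv I (connCoeff nab e b c m) x (e a x) - mvfderiv I (connCoeff nab e a c m) x (e b x)
        - (∑ k, connCoeff nab e a c k x * connCoeff nab e b k m x
          - ∑ k, connCoeff nab e b c k x * connCoeff nab e a k m x)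
        - ∑ k, (connCoeff (leviCivita I M) e a b k x - connCoeff (leviCivita I M) e b a k x)
          * connCoeff nab e k c m x := by
  rw [curvature, inner_sub_left, inner_sub_left, he.inner_nab_nab hstat a b c m hx,
    he.inner_nab_nab hstat b a c m hx, he.mlieBracket_eq a b hx]
  simp only [map_sum, map_smul, sum_inner, real_inner_smul_left]
  simp only [← connCoeff.eq_def]
  ring

lemma commutator (a b : ι) {f : M → ℝ} (hf : ∀ y ∈ U, CMDiffAt ∞ f y) {x : M} (hx : x ∈ U) :
    mvfderiv I (fun y => mvfderiv I f y (e b y)) x (e a x)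
      - mvfderiv I (fun y => mvfderiv I f y (e a y)) x (e b x)
      = ∑ m, (connCoeff (leviCivita I M) e a b m x - connCoeff (leviCivita I M) e b a m x)
        * mvfderiv I f x (e m x) := by
  classical
  have h1 (a : ι) : ∀ᶠ y in 𝓝 x, CMDiffAt ∞ (T% (e a)) y :=
    Filter.Eventually.of_forall fun y => he.smooth a y
  have h2 (a : ι) : MDiffAt (fun y => mvfderiv I f y (e a y)) x :=
    (he.contMDiffAt_deriv a hf hx).mdifferentiableAt (by simp)
  rw [mvfderiv_mlieBracket (Z := e a) (h1 a) (h1 b) (h1 a) ?_ (h2 a) (h2 b) ?_,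
    he.mlieBracket_eq a b hx]
  · simp only [map_sum, map_smul, smul_eq_mul]
  · filter_upwards [he.eventually_mem hx] with y hy using hf y hy
  · exact (he.orthonormal x hx).ne_zero a

end IsOrthonormalFrameOn

end

end StatGeom

namespace StatGeom

noncomputable section

open Topology

/-! ### Transfer of the algebraic formula to the manifold. -/

section BaseChange

variable {R S : Type*} [CommRing R] [CommRing S] {ι : Type*} [Fintype ι]

lemma map_cubicAct (φ : R →+* S) (N : Matrix ι ι R) (T : ι → Matrix ι ι R) (j k l : ι) :
    φ (cubicAct N T j k l) = cubicAct (N.map φ) (fun a => (T a).map φ) j k l := by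
  simp only [cubicAct_apply, map_add, map_sum, map_mul, Matrix.map_apply]

lemma map_cubicInner (φ : R →+* S) (T T' : ι → Matrix ι ι R) :
    φ (cubicInner T T') = cubicInner (fun a => (T a).map φ) (fun a => (T' a).map φ) := by
  simp only [cubicInner, map_sum, map_mul, Matrix.map_apply]

end BaseChange

variable {E : Type*} [NormedAddCommGroup E] [NormedSpace ℝ E] [FiniteDimensional ℝ E]
  {H : Type*} [TopologicalSpace H] {I : ModelWithCorners ℝ E H}
  {M : Type*} [TopologicalSpace M] [ChartedSpace H M] [IsManifold I ∞ M]
  [RiemannianBundle (fun x : M => TangentSpace I x)]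
  [IsContMDiffRiemannianBundle I ∞ E (fun x : M => TangentSpace I x)]

namespace IsOrthonormalFrameOn

variable {ι : Type*} [Fintype ι] {U : Set M} {e : ι → Π x : M, TangentSpace I x}
  (he : IsOrthonormalFrameOn I U e)
  {nab : CovariantDerivative I E (fun x : M => TangentSpace I x)} (hstat : IsStatistical nab)

/-- The Levi-Civita connection matrices of a frame, over the algebra of smooth functions. -/
def leviCivitaMatrix (a : ι) : Matrix ι ι (smoothFunctionsOn I U) :=
  Matrix.of fun b m => smoothFunctionsOn.mk (connCoeff (leviCivita I M) e a b m)
    fun _ hy => he.contMDiffAt_connCoeff_leviCivita hstat a b m hy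

/-- The components of the cubic form in a frame, over the algebra of smooth functions. -/
def cubicMatrix (a : ι) : Matrix ι ι (smoothFunctionsOn I U) :=
  Matrix.of fun b m => smoothFunctionsOn.mk (cubicCoeff nab e a b m)
    fun _ hy => he.contMDiffAt_cubicCoeff hstat a b m hy

lemma leviCivitaMatrix_apply (a b m : ι) (y : U) :
    (he.leviCivitaMatrix hstat a b m).1 y = connCoeff (leviCivita I M) e a b m y := rfl

lemma cubicMatrix_apply (a b m : ι) (y : U) :
    (he.cubicMatrix hstat a b m).1 y = cubicCoeff nab e a b m y := rfl

lemma add_cubicMatrix_apply (a b m : ι) (y : U) :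
    ((he.leviCivitaMatrix hstat + he.cubicMatrix hstat) a b m).1 y = connCoeff nab e a b m y :=
  (he.connCoeff_eq_add hstat a b m y.1).symm

lemma covD_cubicMatrix (a j k l : ι) (y : U) :
    (covD he.deriv (he.leviCivitaMatrix hstat) a (he.cubicMatrix hstat) j k l).1 y
      = covDerivCubicForm nab (e a) (e j) (e k) (e l) y := by
  have h1 := he.deriv_apply a (f := he.cubicMatrix hstat j k l) (F := cubicCoeff nab e j k l)
    (fun _ => rfl) y
  have h2 (X Y : TangentSpace I y.1) (b : ι) :
      cubicForm nab y.1 (leviCivita I M (e b) y (e a y)) X Y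
        = ∑ m, connCoeff (leviCivita I M) e a b m y * cubicForm nab y.1 (e m y) X Y := by
    rw [he.sum_connCoeff_smul _ a b y.2, cubicForm_sum_left]
    simp only [cubicForm_smul_left]
  rw [covDerivCubicForm, h2, cubicForm_swap_left hstat, h2, cubicForm_rotate hstat, h2, covD_apply]
  change (he.deriv a (he.cubicMatrix hstat j k l)).1 y
    - smoothFunctionsOn.eval y (∑ m, he.leviCivitaMatrix hstat a j m * he.cubicMatrix hstat m k l
      + ∑ m, he.leviCivitaMatrix hstat a k m * he.cubicMatrix hstat j m l
      + ∑ m, he.leviCivitaMatrix hstat a l m * he.cubicMatrix hstat j k m) = _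
  rw [h1]
  simp only [map_add, map_sum, map_mul, smoothFunctionsOn.eval_apply, leviCivitaMatrix_apply,
    cubicMatrix_apply]
  have e2 (m) : cubicForm nab y.1 (e m y) (e j y) (e l y) = cubicCoeff nab e j m l y := by
    rw [cubicForm_swap_left hstat]; rfl
  have e3 (m) : cubicForm nab y.1 (e m y) (e j y) (e k y) = cubicCoeff nab e j k m y := by
    rw [cubicForm_swap_left hstat, cubicForm_swap_right]; rfl
  simp only [e2, e3]
  change mvfderiv I (cubicCoeff nab e j k l) y.1 (e a y) - _
    = mvfderiv I (cubicCoeff nab e j k l) y.1 (e a y) - _ - _ - _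
  simp only [cubicCoeff]
  ring

/-- This is where `R = H R₀` enters the frame calculus: the right side is skew in `c` and `m`, as
`codazzi_gauss` requires, and has the form that `curvature_contraction` evaluates. -/
lemma frameCurvature_apply [DecidableEq ι] {h : M → ℝ} (hR : HasCurvature nab h) (a b c m : ι)
    (y : U) : (frameCurvature he.deriv (he.leviCivitaMatrix hstat + he.cubicMatrix hstat)
      (fun a b m => he.leviCivitaMatrix hstat a b m - he.leviCivitaMatrix hstat b a m) a b c m).1 y
      = h y * ((if b = c then 1 else 0) * (if a = m then 1 else 0)
        - (if a = c then 1 else 0) * (if b = m then 1 else 0)) := by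
  have hc := hR (e a) (e b) (e c) (he.smooth a) (he.smooth b) (he.smooth c) y
  have hi := he.inner_curvature hstat a b c m y.2
  rw [hc] at hi
  simp only [real_inner_smul_left, inner_sub_left, he.inner_eq y.2] at hi
  rw [hi]
  set P := he.leviCivitaMatrix hstat + he.cubicMatrix hstat with hP
  have hd (a b c m : ι) := he.deriv_apply a (f := P b c m) (F := connCoeff nab e b c m)
    (fun y => (he.add_cubicMatrix_apply hstat b c m y).symm) y
  have hp (a b m : ι) : (P a b m).1 y = connCoeff nab e a b m y :=
    he.add_cubicMatrix_apply hstat a b m y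
  rw [← hd, ← hd]
  simp only [← hp, ← he.leviCivitaMatrix_apply hstat, ← smoothFunctionsOn.eval_apply,
    ← map_mul, ← map_sub, ← map_sum]
  congr 1
  simp only [frameCurvature, Matrix.sub_apply, Matrix.map_apply, Matrix.mul_apply,
    Matrix.sum_apply, Matrix.smul_apply, smul_eq_mul]

include he in
lemma sum_hessian_eq {f : M → ℝ} {x : M} (hx : x ∈ U) : ∑ a, hessian I f (e a) (e a) x
    = ∑ a, (mvfderiv I (fun y => mvfderiv I f y (e a y)) x (e a x)
      - ∑ m, connCoeff (leviCivita I M) e a a m x * mvfderiv I f x (e m x)) := by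
  refine Finset.sum_congr rfl fun a _ => ?_
  rw [hessian, he.sum_connCoeff_smul _ a a hx]
  simp only [map_sum, map_smul, smul_eq_mul]

include he hstat in
/-- The Bochner–Simons formula of a trace-free statistical structure of constant curvature. -/
lemma sum_hessian_normSqCubicForm (htr : IsTraceFree nab) {h : M → ℝ}
    (hR : HasCurvature nab h) {x : M} (hx : x ∈ U) :
    ∑ a, hessian I (normSqCubicForm nab) (e a) (e a) x
      = 2 * ∑ a, ∑ j, ∑ k, ∑ l, covDerivCubicForm nab (e a) (e j) (e k) (e l) x ^ 2
        + 2 * ((Fintype.card ι + 1) * h x * normSqCubicForm nab x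
          + cubicQuartic fun a b c => cubicCoeff nab e a b c x) := by
  classical
  set W := he.leviCivitaMatrix hstat
  set A := he.cubicMatrix hstat
  set y : U := ⟨x, hx⟩
  -- The Bochner formula holds in the ring of functions, where `A` can be differentiated; evaluation
  -- at `x` is a ring homomorphism and carries it to real matrices.
  let φ : smoothFunctionsOn I U →+* ℝ := (smoothFunctionsOn.eval y).toRingHom
  have hφ (f : smoothFunctionsOn I U) : φ f = f.1 y := rfl
  have hA₁ (a b c) : A a b c = A b a c :=
    smoothFunctionsOn.ext fun z => cubicCoeff_swap_left hstat a b c z.1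
  have hA₂ (a b c) : A a b c = A a c b :=
    smoothFunctionsOn.ext fun z => cubicCoeff_swap_right a b c z.1
  have htr' (c) : ∑ a, A a a c = 0 := smoothFunctionsOn.ext fun z => by
    rw [← smoothFunctionsOn.eval_apply, map_sum]
    exact he.sum_cubicCoeff_eq_zero hstat htr c z.2
  have hq := he.frameCurvature_apply hstat hR
  have hb := bochner_simons he.deriv W
    (fun a i j => smoothFunctionsOn.ext fun z => he.connCoeff_leviCivita_skew a i j z.2)
    (fun a b f => smoothFunctionsOn.ext fun z => by
      have h0 (z : U) := smoothFunctionsOn.lift_apply f z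
      have h1 := he.commutator a b (fun _ => smoothFunctionsOn.lift_smooth f) z.2
      rw [← he.deriv_deriv_apply a b h0 z, ← he.deriv_deriv_apply b a h0 z] at h1
      refine h1.trans ?_
      rw [← smoothFunctionsOn.eval_apply, map_sum]
      refine Finset.sum_congr rfl fun m _ => ?_
      rw [← he.deriv_apply m h0 z]
      rfl) hA₁ hA₂ htr'
    (fun a b i j => smoothFunctionsOn.ext fun z => by
      refine (hq a b i j z).trans ?_
      refine Eq.trans ?_ (congrArg Neg.neg (hq a b j i z).symm)
      ring)
  have hsq (z : U) : normSqCubicForm nab z = (cubicInner A A).1 z := by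
    rw [he.normSqCubicForm_eq hstat z.2, ← smoothFunctionsOn.eval_apply, cubicInner]
    simp only [map_sum, map_mul, sq]
    rfl
  have hc := curvature_contraction (A := fun a => (A a).map φ)
    (fun a b c => congrArg φ (hA₁ a b c)) (fun a b c => congrArg φ (hA₂ a b c))
    (fun c => by
      have := congrArg φ (htr' c)
      rwa [map_sum, map_zero] at this)
    (fun a b i j => hq a b i j y)
  rw [← map_cubicInner, hφ, ← hsq] at hc
  have hcc : cubicQuartic (fun a => (A a).map φ)
    = cubicQuartic fun a b c => cubicCoeff nab e a b c x := rfl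
  rw [hcc] at hc
  rw [← hc]
  have hb' := congrArg φ hb
  rw [he.sum_hessian_eq hx]
  refine Eq.trans ?_ (hb'.trans ?_)
  · rw [map_sum]
    refine Finset.sum_congr rfl fun a _ => ?_
    rw [map_sub, map_sum, hφ, he.deriv_deriv_apply a a hsq y]
    congr 1
    refine Finset.sum_congr rfl fun m _ => ?_
    rw [map_mul, hφ (he.deriv m _), he.deriv_apply m hsq y]
    rfl
  · rw [map_sub, map_mul, map_mul, map_ofNat, map_sum, mul_neg, ← sub_eq_add_neg]
    congr 2
    · refine Finset.sum_congr rfl fun a _ => ?_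
      rw [map_cubicInner, cubicInner]
      refine Finset.sum_congr rfl fun j _ => Finset.sum_congr rfl fun k _ =>
        Finset.sum_congr rfl fun l _ => ?_
      rw [← sq, Matrix.map_apply, hφ, he.covD_cubicMatrix hstat]
    · simp only [map_sum, map_mul, map_cubicAct]
      refine Finset.sum_congr rfl fun j _ => Finset.sum_congr rfl fun k _ =>
        Finset.sum_congr rfl fun l _ => congrArg _ (Finset.sum_congr rfl fun a _ => ?_)
      rw [Matrix.map_add _ (map_add φ), Matrix.map_sub _ (map_sub φ), Matrix.map_mul,
        Matrix.map_mul]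
      rfl

end IsOrthonormalFrameOn

end

end StatGeom

namespace StatGeom

noncomputable section

open Topology

variable {E : Type*} [NormedAddCommGroup E] [NormedSpace ℝ E] [FiniteDimensional ℝ E]
  {H : Type*} [TopologicalSpace H] {I : ModelWithCorners ℝ E H}
  {M : Type*} [TopologicalSpace M] [ChartedSpace H M] [IsManifold I ∞ M]
  [RiemannianBundle (fun x : M => TangentSpace I x)]
  [IsContMDiffRiemannianBundle I ∞ E (fun x : M => TangentSpace I x)]

/-! ### Tensoriality: replacing arbitrary vector extensions by frame fields. -/

namespace IsOrthonormalFrameOn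

variable {ι : Type*} [Fintype ι] {U : Set M} {e : ι → Π x : M, TangentSpace I x}
  (he : IsOrthonormalFrameOn I U e)
  {nab : CovariantDerivative I E (fun x : M => TangentSpace I x)} (hstat : IsStatistical nab)
  {x : M} {X Y Z W Y' Z' W' : Π x : M, TangentSpace I x}

include he

/-- A function of a vector field that is linear over functions on `U` is differentiable if it is so
on the frame. -/
lemma mdifferentiableAt_linear (hx : x ∈ U) (φ : ∀ y, TangentSpace I y →ₗ[ℝ] ℝ)
    (hφ : ∀ a, MDiffAt (fun y => φ y (e a y)) x) (hY : MDiffAt (T% Y) x) :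
    MDiffAt (fun y => φ y (Y y)) x := by
  have h : MDiffAt (∑ a, (fun y => (inner ℝ (e a y) (Y y) : ℝ)) * fun y => φ y (e a y)) x :=
    Finset.sum_induction _ (fun f : M → ℝ => MDiffAt f x) (fun _ _ h h' => h.add h')
      mdifferentiableAt_const fun a _ => (mdiffAt_inner (he.mdifferentiableAt a x) hY).mul (hφ a)
  refine h.congr_of_eventuallyEq ?_
  filter_upwards [he.eventually_mem hx] with y hy
  conv_lhs => rw [← he.sum_inner_smul hy (Y y)]
  simp

lemma mdifferentiableAt_mvfderiv (hx : x ∈ U) {f : M → ℝ} (hf : ∀ y ∈ U, CMDiffAt ∞ f y)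
    (hY : MDiffAt (T% Y) x) : MDiffAt (fun y => mvfderiv I f y (Y y)) x :=
  he.mdifferentiableAt_linear hx (fun y => (mvfderiv I f y).toLinearMap)
    (fun a => (he.contMDiffAt_deriv a hf hx).mdifferentiableAt (by simp)) hY

/-- The term `(X g)(Y f)` from differentiating `g • Y` cancels between the two parts of the Hessian.
Hence the extensions in `laplacian` may be replaced by frame fields. -/
lemma hessian_tensorial (hx : x ∈ U) {f : M → ℝ} (hf : ∀ y ∈ U, CMDiffAt ∞ f y) :
    TensorialAt I E (fun Y : Π x : M, TangentSpace I x => hessian I f X Y x) x where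
  smul {g Y} hg hY := by
    have h := mvfderiv_mul hg (he.mdifferentiableAt_mvfderiv hx hf hY)
    have e1 : (fun y => mvfderiv I f y ((g • Y) y)) = g * fun y => mvfderiv I f y (Y y) := by
      funext y; simp
    rw [hessian, e1, h, (leviCivita I M).isCovariantDerivativeOn.leibniz hY hg, hessian]
    simp
    ring
  add {Y Y'} hY hY' := by
    have h := mvfderiv_add (he.mdifferentiableAt_mvfderiv hx hf hY)
      (he.mdifferentiableAt_mvfderiv hx hf hY')
    have e1 : (fun y => mvfderiv I f y ((Y + Y') y))
        = (fun y => mvfderiv I f y (Y y)) + fun y => mvfderiv I f y (Y' y) := by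
      funext y; simp
    rw [hessian, e1, h, (leviCivita I M).isCovariantDerivativeOn.add hY hY', hessian, hessian]
    simp
    ring


include hstat

lemma mdifferentiableAt_cubicForm (hx : x ∈ U) (hY : MDiffAt (T% Y) x) (hZ : MDiffAt (T% Z) x)
    (hW : MDiffAt (T% W) x) : MDiffAt (fun y => cubicForm nab y (Y y) (Z y) (W y)) x := by
  refine he.mdifferentiableAt_linear hx (fun y => cubicFormLinear nab y (Z y) (W y))
    (fun a => ?_) hY
  -- The arguments are freed one at a time, using symmetry to bring each to the first slot: the
  -- third, then the second, then the first.
  have h (b c) : MDiffAt (fun y => cubicForm nab y (e a y) (e b y) (e c y)) x :=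
    (he.contMDiffAt_cubicCoeff hstat a b c hx).mdifferentiableAt (by simp)
  have h1 (b) : MDiffAt (fun y => cubicForm nab y (e a y) (e b y) (W y)) x := by
    simp only [cubicForm_rotate hstat _ (e a _)] at h ⊢
    exact he.mdifferentiableAt_linear hx (fun y => cubicFormLinear nab y (e a y) (e b y))
      (fun c => h b c) hW
  change MDiffAt (fun y => cubicForm nab y (e a y) (Z y) (W y)) x
  simp only [cubicForm_swap_left hstat _ (e a _)] at h1 ⊢
  exact he.mdifferentiableAt_linear hx (fun y => cubicFormLinear nab y (e a y) (W y)) h1 hZ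

lemma covDerivCubicForm_tensorial (hx : x ∈ U) (hZ : MDiffAt (T% Z) x) (hW : MDiffAt (T% W) x) :
    TensorialAt I E (fun Y : Π x : M, TangentSpace I x => covDerivCubicForm nab X Y Z W x) x where
  smul {g Y} hg hY := by
    have h := mvfderiv_mul hg (he.mdifferentiableAt_cubicForm hstat hx hY hZ hW)
    have e1 : (fun y => cubicForm nab y ((g • Y) y) (Z y) (W y))
        = g * fun y => cubicForm nab y (Y y) (Z y) (W y) := by
      funext y; simp [cubicForm_smul_left]
    rw [covDerivCubicForm, e1, h, (leviCivita I M).isCovariantDerivativeOn.leibniz hY hg,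
      covDerivCubicForm]
    simp [cubicForm_smul_left, cubicForm_add_left]
    ring
  add {Y Y'} hY hY' := by
    have h := mvfderiv_add (he.mdifferentiableAt_cubicForm hstat hx hY hZ hW)
      (he.mdifferentiableAt_cubicForm hstat hx hY' hZ hW)
    have e1 : (fun y => cubicForm nab y ((Y + Y') y) (Z y) (W y))
        = (fun y => cubicForm nab y (Y y) (Z y) (W y))
          + fun y => cubicForm nab y (Y' y) (Z y) (W y) := by
      funext y; simp [cubicForm_add_left]
    rw [covDerivCubicForm, e1, h, (leviCivita I M).isCovariantDerivativeOn.add hY hY',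
      covDerivCubicForm, covDerivCubicForm]
    simp [cubicForm_add_left]
    ring

omit [Fintype ι] he in
lemma covDerivCubicForm_swap_left :
    covDerivCubicForm nab X Y Z W x = covDerivCubicForm nab X Z Y W x := by
  have h (y) := cubicForm_swap_left hstat y
  simp only [covDerivCubicForm, fun y => h y (Y y), h x (leviCivita I M Y x (X x))]
  ring

omit [Fintype ι] he in
lemma covDerivCubicForm_rotate :
    covDerivCubicForm nab X Y Z W x = covDerivCubicForm nab X W Y Z x := by
  have h (y) := cubicForm_rotate hstat y
  simp only [covDerivCubicForm, fun y => h y (Y y), h x (leviCivita I M Y x (X x))]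
  ring

/-- The derivative of the cubic form is a tensor. -/
lemma covDerivCubicForm_congr (hx : x ∈ U) {X' : Π x : M, TangentSpace I x}
    (hY : MDiffAt (T% Y) x) (hY' : MDiffAt (T% Y') x) (hZ : MDiffAt (T% Z) x)
    (hZ' : MDiffAt (T% Z') x) (hW : MDiffAt (T% W) x) (hW' : MDiffAt (T% W') x)
    (h₁ : X x = X' x) (h₂ : Y x = Y' x) (h₃ : Z x = Z' x) (h₄ : W x = W' x) :
    covDerivCubicForm nab X Y Z W x = covDerivCubicForm nab X' Y' Z' W' x := by
  have e1 : covDerivCubicForm nab X Y Z W x = covDerivCubicForm nab X' Y Z W x := by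
    simp only [covDerivCubicForm, h₁]
  rw [e1, (he.covDerivCubicForm_tensorial hstat hx hZ hW).pointwise hY hY' h₂,
    covDerivCubicForm_swap_left hstat,
    (he.covDerivCubicForm_tensorial hstat hx hY' hW).pointwise hZ hZ' h₃,
    covDerivCubicForm_swap_left hstat, covDerivCubicForm_rotate hstat,
    (he.covDerivCubicForm_tensorial hstat hx hY' hZ').pointwise hW hW' h₄,
    ← covDerivCubicForm_rotate hstat]

lemma contMDiffAt_normSqCubicForm (hx : x ∈ U) : CMDiffAt ∞ (normSqCubicForm nab) x := by
  have h : CMDiffAt ∞ (fun y => ∑ a, ∑ b, ∑ c, cubicCoeff nab e a b c y ^ 2) x :=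
    ContMDiffAt.sum fun a _ => ContMDiffAt.sum fun b _ => ContMDiffAt.sum fun c _ =>
      (he.contMDiffAt_cubicCoeff hstat a b c hx).pow 2
  refine h.congr_of_eventuallyEq ?_
  filter_upwards [he.eventually_mem hx] with y hy using he.normSqCubicForm_eq hstat hy

end IsOrthonormalFrameOn

/-! ### The Bochner–Simons formula at a point and the resulting bounds. -/

/-- The Bochner–Simons formula: `½ Δ‖A‖² = ‖∇̂A‖² + (n + 1) h ‖A‖² + cubicQuartic A`. -/
theorem laplacian_normSqCubicForm [T2Space M]
    {nab : CovariantDerivative I E (fun x : M => TangentSpace I x)} (hstat : IsStatistical nab)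
    (htr : IsTraceFree nab) {h : M → ℝ} (hR : HasCurvature nab h) (x : M) :
    1 / 2 * laplacian I (normSqCubicForm nab) x
      = normSqCovDerivCubicForm nab x + ((Module.finrank ℝ E + 1) * h x * normSqCubicForm nab x
        + cubicQuartic fun a b c => cubicForm nab x (onb I x a) (onb I x b) (onb I x c)) := by
  obtain ⟨U, e, hx, he, hex⟩ := exists_orthonormalFrame I x
  have hd (v : TangentSpace I x) := FiberBundle.mdifferentiableAt_extend I E v
  have hv (a) : FiberBundle.extend E (onb I x a) x = e a x := by rw [hex]; simp
  have h1 : laplacian I (normSqCubicForm nab) x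
      = ∑ a, hessian I (normSqCubicForm nab) (e a) (e a) x := by
    refine Finset.sum_congr rfl fun a _ => ?_
    refine ((he.hessian_tensorial hx fun y hy => he.contMDiffAt_normSqCubicForm hstat hy).pointwise
      (hd _) (he.mdifferentiableAt a x) (hv a)).trans ?_
    simp only [hessian, hv]
  have h2 : normSqCovDerivCubicForm nab x
      = ∑ a, ∑ j, ∑ k, ∑ l, covDerivCubicForm nab (e a) (e j) (e k) (e l) x ^ 2 := by
    refine Finset.sum_congr rfl fun a _ => Finset.sum_congr rfl fun j _ =>
      Finset.sum_congr rfl fun k _ => Finset.sum_congr rfl fun l _ => ?_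
    rw [he.covDerivCubicForm_congr hstat hx (hd _) (he.mdifferentiableAt j x) (hd _)
      (he.mdifferentiableAt k x) (hd _) (he.mdifferentiableAt l x) (hv a) (hv j) (hv k) (hv l)]
  rw [h1, h2, he.sum_hessian_normSqCubicForm hstat htr hR hx, he.card]
  simp only [cubicCoeff, hex]
  ring

end

end StatGeom

theorem theorem5p1 {n : ℕ} (hn : 2 ≤ n) {M : Type*} [TopologicalSpace M] [T2Space M]
    [ChartedSpace (EuclideanSpace ℝ (Fin n)) M] [IsManifold (𝓡 n) ∞ M]
    [RiemannianBundle (fun x : M => TangentSpace (𝓡 n) x)]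
    [IsContMDiffRiemannianBundle (𝓡 n) ∞ (EuclideanSpace ℝ (Fin n))
      (fun x : M => TangentSpace (𝓡 n) x)]
    (nab : CovariantDerivative (𝓡 n) (EuclideanSpace ℝ (Fin n))
      (fun x : M => TangentSpace (𝓡 n) x))
    (hstat : StatGeom.IsStatistical nab) (htr : StatGeom.IsTraceFree nab)
    (H : M → ℝ) (hR : StatGeom.HasCurvature nab H)
    (u : M → ℝ) (hu : u = StatGeom.normSqCubicForm nab) :
    (∀ x : M,
      ((n : ℝ) + 1) * H x * u x + ((n : ℝ) + 1) / ((n : ℝ) * ((n : ℝ) - 1)) * u x ^ 2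
          + StatGeom.normSqCovDerivCubicForm nab x
        ≤ 1 / 2 * StatGeom.laplacian (𝓡 n) u x ∧
      1 / 2 * StatGeom.laplacian (𝓡 n) u x
        ≤ ((n : ℝ) + 1) * H x * u x + 3 / 2 * u x ^ 2
          + StatGeom.normSqCovDerivCubicForm nab x) ∧
    (n = 2 → ∀ x : M,
      ((n : ℝ) + 1) * H x * u x + ((n : ℝ) + 1) / ((n : ℝ) * ((n : ℝ) - 1)) * u x ^ 2
          + StatGeom.normSqCovDerivCubicForm nab x
        = 1 / 2 * StatGeom.laplacian (𝓡 n) u x ∧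
      1 / 2 * StatGeom.laplacian (𝓡 n) u x
        = ((n : ℝ) + 1) * H x * u x + 3 / 2 * u x ^ 2
          + StatGeom.normSqCovDerivCubicForm nab x) := by
  subst hu
  have main (x : M) :
      ((n : ℝ) + 1) * H x * StatGeom.normSqCubicForm nab x
          + ((n : ℝ) + 1) / ((n : ℝ) * ((n : ℝ) - 1)) * StatGeom.normSqCubicForm nab x ^ 2
          + StatGeom.normSqCovDerivCubicForm nab x
        ≤ 1 / 2 * StatGeom.laplacian (𝓡 n) (StatGeom.normSqCubicForm nab) x ∧
      1 / 2 * StatGeom.laplacian (𝓡 n) (StatGeom.normSqCubicForm nab) x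
        ≤ ((n : ℝ) + 1) * H x * StatGeom.normSqCubicForm nab x
          + 3 / 2 * StatGeom.normSqCubicForm nab x ^ 2
          + StatGeom.normSqCovDerivCubicForm nab x := by
    have hfr : Module.finrank ℝ (TangentSpace (𝓡 n) x) = n :=
      finrank_euclideanSpace_fin (𝕜 := ℝ) (n := n)
    have h := StatGeom.laplacian_normSqCubicForm hstat htr hR x
    have hA₁ (a b c) := StatGeom.cubicForm_swap_left hstat x (StatGeom.onb (𝓡 n) x a)
      (StatGeom.onb (𝓡 n) x b) (StatGeom.onb (𝓡 n) x c)
    have hA₂ (a b c) := StatGeom.cubicForm_swap_right (nab := nab) x (StatGeom.onb (𝓡 n) x a)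
      (StatGeom.onb (𝓡 n) x b) (StatGeom.onb (𝓡 n) x c)
    have hle := StatGeom.cubicQuartic_le hA₂
    have hge := StatGeom.le_cubicQuartic hA₁ hA₂ (fun a => htr x (StatGeom.onb (𝓡 n) x a))
      (n := n) (by rw [Fintype.card_fin, hfr]) (by exact_mod_cast hn)
    rw [finrank_euclideanSpace_fin] at h
    rw [h]
    change _ ≤ 3 / 2 * StatGeom.normSqCubicForm nab x ^ 2 at hle
    change _ * StatGeom.normSqCubicForm nab x ^ 2 ≤ _ at hge
    constructor <;> linarith
  refine ⟨main, ?_⟩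
  rintro rfl x
  obtain ⟨h₁, h₂⟩ := main x
  -- For `n = 2` the lower constant equals the upper one, so the two inequalities pinch.
  have h₃ : (((2 : ℕ) : ℝ) + 1) / (((2 : ℕ) : ℝ) * (((2 : ℕ) : ℝ) - 1)) = 3 / 2 := by norm_num
  rw [h₃] at h₁ ⊢
  constructor <;> linarith
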